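/- Let $m,n\ge 2$ be integers. Let $G^+_{m,n}$ and $G_{m,n}$ be the monoid and the group with generators $s,t_1,\dots,t_m,u_1,\dots,u_n$ and defining relations $[s,t_1,\dots,t_m]$, $[s,u_1,\dots,u_n]$ and $[t_i,u_j]$ $(1\le i\le m,\ 1\le j\le n)$, where $[x_1,\dots,x_k]$ denotes the cyclic relations $$x_1x_2\cdots x_k = x_2\cdots x_kx_1=\cdots = x_kx_1\cdots x_{k-1}.$$ Put $\Delta = s\,t_1\cdots t_m\,u_1\cdots u_n\in G^+_{m,n}$. For elements of $G^+_{m,n}$ write $a\mid_l b$ (resp. $a\mid_r b$) if $b=ac$ (resp. $b=ca$) for some $c\in G^+_{m,n}$. For $w\in G^+_{m,n}$ put $$\mathrm{Trans}(w)=\{A\in G^+_{m,n} : A\ne 1,\ AQ=wA\text{ for some }Q\in G^+_{m,n}\},\qquad \mathrm{Conj}^+(w)=\{V\in G^+_{m,n} : AV=wA\text{ for some }A\in G^+_{m,n}\},$$ $$O^{(1)}(w;\Delta)=\{V : AV=wA\text{ for some }A\mid_l\Delta\},\qquad O^{(k+1)}(w;\Delta)=\{V : AV=UA\text{ for some }U\in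 O^{(k)}(w;\Delta),\ A\mid_l\Delta\},$$ and $O(w;\Delta)=\bigcup_{k\ge1}O^{(k)}(w;\Delta)$. Then: 1. The monoid $G^+_{m,n}$ is cancellative ($axb=ayb$ implies $x=y$), and $\Delta$ is a fundamental element: there is a permutation $\sigma$ of the set of generators such that for each generator $g$ there is $\Delta_g\in G^+_{m,n}$ with $\Delta=g\Delta_g=\Delta_g\,\sigma(g)$. 2. Every $w\in G^+_{m,n}$ has the property $\mathrm{P}(w;\Delta)$: for every $A\in\mathrm{Trans}(w)$ there is $\delta\in\mathrm{Trans}(w)$ with $\delta\mid_l A$ and $\delta\mid_l\Delta$. 3. For every $w\in G^+_{m,n}$ there is $k_0\ge1$ with $O^{(k)}(w;\Delta)=O(w;\Delta)$ for all $k\ge k_0$, and $O(w;\Delta)=\mathrm{Conj}^+(w)$. 4. The conjugacy problem in $G^+_{m,n}$ is solvable: there is an algorithm that decides, for any two positive words $U,V$ in the generators, whether $AU=VA$ for some $A\in G^+_{m,n}$. 5. The conjugacy problem in the group $G_{m,n}$ is solvable: there is an algorithm that decides whether two words in the generators and their inverses represent conjugate elements of $G_{m,n}$. 6. $G^+_{m,n}$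 satisfies neither the right nor the left LCM condition: it is not true that any two elements $a,b$ have a right least common multiple (an element $c$ with $a\mid_l c$, $b\mid_l c$ such that $c\mid_l d$ for every $d$ with $a\mid_l d$, $b\mid_l d$), and it is not true that any two elements have a left least common multiple (the same with $\mid_r$ in place of $\mid_l$). -/

import Mathlib

/-! ### Divisibility, common multiples, fundamental elements, transit elements

Throughout, `a ∣ b` in a (non-commutative) monoid is Mathlib's divisibility `∃ c, b = a * c`,
that is, `a` divides `b` from the left. -/

namespace ConjProblem

section Monoid

variable {M : Type*} [Monoid M]

/-- `a` divides `b` from the right: `b = c * a` for some `c`. -/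
def RightDvd (a b : M) : Prop := ∃ c, b = c * a

/-- The right LCM condition: any two elements `a`, `b` admit a right least common multiple,
i.e. an element divisible from the left by `a` and by `b`, which divides from the left every other
such element. -/
def RightLCMCondition (M : Type*) [Monoid M] : Prop :=
  ∀ a b : M, ∃ c, a ∣ c ∧ b ∣ c ∧ ∀ d, a ∣ d → b ∣ d → c ∣ d

/-- The left LCM condition: the mirror image of the right one. -/
def LeftLCMCondition (M : Type*) [Monoid M] : Prop :=
  ∀ a b : M, ∃ c, RightDvd a c ∧ RightDvd b c ∧
    ∀ d, RightDvd a d → RightDvd b d → RightDvd c d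

/-- `M` is cancellative: `a x b = a y b` implies `x = y`. -/
def Cancellative (M : Type*) [Monoid M] : Prop :=
  ∀ a b x y : M, a * x * b = a * y * b → x = y

/-- `D` is a fundamental element with respect to the generators `g i`, `i : L`: for some
permutation `σ` of the generators, every generator `g i` has a complement `D_i` with
`D = (g i) D_i = D_i (g (σ i))`. (For presentations in which no generator is redundant.) -/
def IsFundamental {L : Type*} (g : L → M) (D : M) : Prop :=
  ∃ σ : Equiv.Perm L, ∀ i, ∃ Di, D = g i * Di ∧ D = Di * g (σ i)

/-- The right transit elements of `w`: the elements `A ≠ 1` with `A Q = w A` for some `Q`. -/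
def Trans (w : M) : Set M := {A | A ≠ 1 ∧ ∃ Q, A * Q = w * A}

/-- The property `P(w; D)`: every right transit element `A` of `w` is divisible from the left by a
right transit element of `w` that divides `D` from the left. -/
def PropertyP (w D : M) : Prop :=
  ∀ A ∈ Trans w, ∃ δ ∈ Trans w, δ ∣ A ∧ δ ∣ D

/-- `Conj⁺(w)`: all `V` with `A V = w A` for some `A`. -/
def ConjPlus (w : M) : Set M := {V | ∃ A, A * V = w * A}

/-- `O^(k)(w; D)`. Here `O^(0)(w; D) = {w}`, so that
`O^(1)(w; D) = {V | A V = w A for some left divisor A of D}`. -/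
def OIter (w D : M) : ℕ → Set M
  | 0 => {w}
  | k + 1 => {V | ∃ U ∈ OIter w D k, ∃ A, A ∣ D ∧ A * V = U * A}

/-- `O(w; D)`, the union of the increasing chain `O^(1)(w; D) ⊆ O^(2)(w; D) ⊆ ⋯`. -/
def OSet (w D : M) : Set M := {V | ∃ k, 1 ≤ k ∧ V ∈ OIter w D k}

end Monoid

/-! ### Positive presentations and the conjugacy problem -/

section Presentations

variable {L : Type*}

/-- The group with generators `L` and the positive relations `a = b` for `R a b`. -/
abbrev PosGroup (R : FreeMonoid L → FreeMonoid L → Prop) : Type _ :=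
  PresentedGroup {g : FreeGroup L | ∃ a b, R a b ∧
    g = FreeMonoid.lift FreeGroup.of a * (FreeMonoid.lift FreeGroup.of b)⁻¹}

/-- The element of the monoid `⟨L | R⟩` represented by a positive word. -/
def monoidElt (R : FreeMonoid L → FreeMonoid L → Prop) (U : List L) : PresentedMonoid R :=
  PresentedMonoid.mk R (FreeMonoid.ofList U)

/-- The element of the group `⟨L | R⟩` represented by a word in the letters and their inverses;
`(l, true)` stands for `l` and `(l, false)` for its inverse. -/
def groupElt (R : FreeMonoid L → FreeMonoid L → Prop) (U : List (L × Bool)) : PosGroup R :=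
  PresentedGroup.mk _ (FreeGroup.mk U)

/-- The conjugacy problem in the monoid `⟨L | R⟩` is solvable: there is an algorithm that decides
for positive words `U`, `V` whether `A U = V A` for some element `A` of the monoid. -/
def MonoidConjugacySolvable [Primcodable L] (R : FreeMonoid L → FreeMonoid L → Prop) : Prop :=
  ComputablePred fun p : List L × List L =>
    ∃ A : PresentedMonoid R, A * monoidElt R p.1 = monoidElt R p.2 * A

/-- The conjugacy problem in the group `⟨L | R⟩` is solvable: there is an algorithm that decides
whether two words represent conjugate elements of the group. -/
def GroupConjugacySolvable [Primcodable L] (R : FreeMonoid L → FreeMonoid L → Prop) : Prop :=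
  ComputablePred fun p : List (L × Bool) × List (L × Bool) =>
    IsConj (groupElt R p.1) (groupElt R p.2)

end Presentations

/-! ### The monoids `G⁺_{m,n}` and the groups `G_{m,n}` -/

/-- The alphabet `s, t_1, …, t_m, u_1, …, u_n` (indices shifted to start at `0`). -/
abbrev Gen (m n : ℕ) : Type := Unit ⊕ (Fin m ⊕ Fin n)

variable {m n : ℕ}

/-- The letter `s`. -/
def Gen.s : Gen m n := Sum.inl ()

/-- The letters `t_i`. -/
def Gen.t (i : Fin m) : Gen m n := Sum.inr (Sum.inl i)

/-- The letters `u_j`. -/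
def Gen.u (j : Fin n) : Gen m n := Sum.inr (Sum.inr j)

/-- The cyclic relations `[x_1, …, x_k]`: the word `x_1 ⋯ x_k` equals each of its cyclic rotations
`x_{i+1} ⋯ x_k x_1 ⋯ x_i`. -/
def CyclicRel {L : Type*} (x : List L) (a b : FreeMonoid L) : Prop :=
  ∃ i : ℕ, a = FreeMonoid.ofList x ∧ b = FreeMonoid.ofList (x.rotate i)

/-- The word `t_1 ⋯ t_m`. -/
def tWord (m n : ℕ) : List (Gen m n) := List.ofFn Gen.t

/-- The word `u_1 ⋯ u_n`. -/
def uWord (m n : ℕ) : List (Gen m n) := List.ofFn Gen.u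

/-- The defining relations `[s, t_1, …, t_m]`, `[s, u_1, …, u_n]`, `[t_i, u_j]`. -/
def GRel (m n : ℕ) (a b : FreeMonoid (Gen m n)) : Prop :=
  CyclicRel (Gen.s :: tWord m n) a b ∨ CyclicRel (Gen.s :: uWord m n) a b ∨
    ∃ i j, CyclicRel [Gen.t i, Gen.u j] a b

/-- The monoid `G⁺_{m,n}`. -/
abbrev GPlus (m n : ℕ) : Type := PresentedMonoid (GRel m n)

/-- The image of a letter in `G⁺_{m,n}`. -/
def letter (l : Gen m n) : GPlus m n := monoidElt (GRel m n) [l]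

/-- The element `Δ = s t_1 ⋯ t_m u_1 ⋯ u_n` of `G⁺_{m,n}`. -/
def Delta (m n : ℕ) : GPlus m n :=
  monoidElt (GRel m n) (Gen.s :: (tWord m n ++ uWord m n))

end ConjProblem

/-! Let C_k be the monoid with the single cyclic relation [x_0, …, x_k] (`CycleMonoid`) and c = x_0
⋯ x_k. All full cycles equal c, so c is central and every element is a power of c times a word
containing no full cycle; such a word is the only one for its element
(`Reduced.eq_of_monoidElt_eq`). Letting the letters act on these normal forms, with exponents of c
in ℤ, embeds C_k in a group (`actHom_injective`).

Deleting the u_j, respectively the t_i, identifies G⁺ with the pairs in C_m × C_n that have the same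
exponent of s (`eq_of_proj_eq`, `exists_proj_eq`). Cancellation and divisibility can thus be checked
in coordinates, and Δ becomes the central pair (c, c). For property P, each nontrivial coordinate of
A yields a small transit element: c itself, or the longest arc of consecutive letters at the front
(`exists_transit_dvd_cycleElt`). It divides c, so its s-exponent is 0 or 1, which lets the
coordinates be matched. Peeling such factors off a conjugator gives O = Conj⁺ by induction on
length; this set is finite because the relations preserve length. The LCM conditions fail because
t_1, t_2 have two common multiples whose u-coordinates share no divisor on the relevant side, while
every common multiple of t_1, t_2 contains an s.

The group is F_m × F_n × ⟨Δ⟩ (`ofFree_comp` gives the half that is needed), so its conjugacy problem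
is that of free groups, where conjugacy means rotation of cyclically reduced words. A conjugator
between positive elements becomes positive after multiplication by a power of Δ, so the monoid
problem reduces to the group problem (`isConj_toGroup_iff`). -/

namespace FreeGroup

/-! ### Conjugacy in free groups -/

variable {α : Type*}

theorem IsCyclicallyReduced.append_singleton {b : α × Bool} {L : List (α × Bool)}
    (h : IsCyclicallyReduced (b :: L)) : IsCyclicallyReduced (L ++ [b]) := by
  obtain ⟨h₁, h₂⟩ := h
  rcases List.eq_nil_or_concat' L with rfl | ⟨L', a, rfl⟩
  · simp
  have h₁' : IsReduced (L' ++ [a]) := (List.isChain_cons.1 h₁).2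
  refine ⟨List.isChain_append.2 ⟨h₁', List.isChain_singleton _, ?_⟩, ?_⟩
  · intro x hx y hy
    obtain rfl : b = y := by simpa using hy
    exact h₂ x (by rwa [← List.cons_append, List.getLast?_concat, ← List.getLast?_concat]) b rfl
  · have := (List.isChain_cons.1 h₁).1
    intro x hx y hy hxy
    obtain rfl : b = x := by simpa using hx
    refine this y ?_ hxy
    cases L' <;> simpa using hy

theorem IsCyclicallyReduced.cons_of_append_singleton {b : α × Bool} {L : List (α × Bool)}
    (h : IsCyclicallyReduced (L ++ [b])) : IsCyclicallyReduced (b :: L) := by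
  obtain ⟨h₁, h₂⟩ := h
  obtain ⟨hL, -, h₃⟩ := List.isChain_append.1 h₁
  rcases L with - | ⟨a, L⟩
  · simp
  refine ⟨List.isChain_cons.2 ⟨?_, hL⟩, ?_⟩
  · intro y hy
    exact h₂ b (by rw [List.getLast?_concat]; rfl) y hy
  · intro x hx y hy hxy
    obtain rfl : b = y := by simpa using hy
    refine h₃ x ?_ _ (by simp) hxy
    simpa [List.getLast?_cons_cons] using hx

theorem mk_cons (a : α × Bool) (L : List (α × Bool)) : mk (a :: L) = mk [a] * mk L := rfl

theorem mk_append (L₁ L₂ : List (α × Bool)) : mk (L₁ ++ L₂) = mk L₁ * mk L₂ := rfl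

theorem mk_singleton_inv (a : α) (e : Bool) : (mk [(a, e)])⁻¹ = mk [(a, !e)] := rfl

/-- Conjugate cyclically reduced words are rotations of each other. -/
theorem IsCyclicallyReduced.isRotated [DecidableEq α] {C D : List (α × Bool)}
    (hC : IsCyclicallyReduced C) (hD : IsCyclicallyReduced D) (g : List (α × Bool))
    (hg : IsReduced g) (h : mk g * mk C * (mk g)⁻¹ = mk D) : C ~r D := by
  -- Peel off the last letter of the conjugator. If it cancels against an end of `C`, its effect is
  -- to rotate `C` by one letter, and the shorter conjugator remains.
  induction g using List.reverseRecOn generalizing C with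
  | nil =>
    have h' : mk C = mk D := by
      rw [← h, ← one_eq_mk]
      simp
    have := reduce.sound h'
    rw [hC.1.reduce_eq, hD.1.reduce_eq] at this
    rw [this]
  | append_singleton g' a ih =>
    obtain ⟨hg', -, hga⟩ := List.isChain_append.1 hg
    obtain ⟨x, e⟩ := a
    by_cases h₁ : C.head? = some (x, !e)
    · obtain ⟨C₁, rfl⟩ : ∃ C₁, C = (x, !e) :: C₁ := by
        cases C <;> simp_all
      refine List.IsRotated.trans ?_
        (ih hC.append_singleton hg' ?_)
      · exact ⟨1, by simp⟩
      · rw [← h, mk_append g', mk_append C₁, mk_cons _ C₁, ← mk_singleton_inv]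
        group
    by_cases h₂ : C.getLast? = some (x, e)
    · obtain ⟨C₁, rfl⟩ : ∃ C₁, C = C₁ ++ [(x, e)] := by
        rcases List.eq_nil_or_concat' C with rfl | ⟨L', a, rfl⟩ <;> simp_all
      refine List.IsRotated.trans (List.IsRotated.symm ?_) (ih hC.cons_of_append_singleton hg' ?_)
      · exact ⟨1, by simp⟩
      · rw [← h, mk_append g', mk_append C₁, mk_cons _ C₁]
        group
    rcases eq_or_ne C [] with rfl | hne
    · have h' : mk D = mk [] := by
        rw [← h, ← one_eq_mk, mul_one, mul_inv_cancel]
      have := reduce.sound h'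
      rw [hD.1.reduce_eq] at this
      rw [this, reduce_nil]
    -- With no cancellation at either junction, g C g⁻¹ is already reduced and so is `D` itself; but
    -- it ends with the inverse of its first letter.
    exfalso
    have hred : IsReduced (g' ++ [(x, e)] ++ C ++ invRev (g' ++ [(x, e)])) := by
      refine List.isChain_append.2 ⟨List.isChain_append.2 ⟨hg, hC.1, ?_⟩, ?_, ?_⟩
      · intro p hp q hq hpq
        obtain rfl : (x, e) = p := by simpa using hp
        obtain ⟨y, f⟩ := q
        obtain rfl : x = y := hpq
        by_contra hne
        refine h₁ (hq.trans ?_)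
        cases e <;> cases f <;> simp_all
      · have := isReduced_iff_reduce_eq.1 hg
        exact isReduced_iff_reduce_eq.2 (by rw [reduce_invRev, this])
      · intro p hp q hq hpq
        have hp' : p ∈ C.getLast? := by
          rwa [List.getLast?_append_of_ne_nil _ hne] at hp
        obtain rfl : (x, !e) = q := by simpa [invRev] using hq
        obtain ⟨y, f⟩ := p
        obtain rfl : y = x := hpq
        by_contra hne
        refine h₂ (hp'.trans ?_)
        cases e <;> cases f <;> simp_all
    have hD' : D = g' ++ [(x, e)] ++ C ++ invRev (g' ++ [(x, e)]) := by
      have := reduce.sound (show mk (g' ++ [(x, e)] ++ C ++ invRev (g' ++ [(x, e)])) = mk D by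
        rw [← h, mk_append, mk_append _ C, inv_mk])
      rw [hred.reduce_eq, hD.1.reduce_eq] at this
      exact this.symm
    obtain ⟨b, g₁, hb⟩ : ∃ b g₁, g' ++ [(x, e)] = b :: g₁ := by
      cases g' <;> simp
    have := hD.2 (b.1, !b.2) (by
      rw [hD', hb, List.getLast?_append_of_ne_nil _ (by simp [invRev])]
      simp [invRev]) b (by rw [hD', hb]; simp) rfl
    cases hh : b.2 <;> simp_all

theorem isConj_mk_rotate (L : List (α × Bool)) (i : ℕ) :
    IsConj (mk L) (mk (L.drop i ++ L.take i)) := by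
  rw [isConj_iff]
  refine ⟨(mk (L.take i))⁻¹, ?_⟩
  have h : mk L = mk (L.take i) * mk (L.drop i) := by
    rw [← mk_append, List.take_append_drop]
  rw [h, mk_append]
  group

/-- Two words represent conjugate elements of a free group if and only if their reductions have
rotations that represent the same element. -/
theorem isConj_mk_iff [DecidableEq α] (U V : List (α × Bool)) :
    IsConj (mk U) (mk V) ↔ ∃ i < (reduce U).length + 1, ∃ j < (reduce V).length + 1,
      reduce ((reduce U).drop i ++ (reduce U).take i) =
        reduce ((reduce V).drop j ++ (reduce V).take j) := by
  constructor
  · intro h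
    rw [← reduce.self (L := U), ← reduce.self (L := V)] at h
    have hU : IsReduced (reduce U) := isReduced_iff_reduce_eq.2 reduce.idem
    have hV : IsReduced (reduce V) := isReduced_iff_reduce_eq.2 reduce.idem
    generalize reduce U = U at *
    generalize reduce V = V at *
    have cU := reduceCyclically.conj_conjugator_reduceCyclically U
    have cV := reduceCyclically.conj_conjugator_reduceCyclically V
    have hC := reduceCyclically.isCyclicallyReduced hU
    have hD := reduceCyclically.isCyclicallyReduced hV
    generalize reduceCyclically U = C at *
    generalize reduceCyclically V = D at *
    generalize reduceCyclically.conjugator U = p at *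
    generalize reduceCyclically.conjugator V = q at *
    have hconj : IsConj (mk C) (mk D) := by
      have e : ∀ r E : List (α × Bool), IsConj (mk E) (mk (r ++ E ++ invRev r)) := fun r E => by
        rw [isConj_iff]
        exact ⟨mk r, by rw [mk_append, mk_append, inv_mk]⟩
      have e₁ := e p C
      have e₂ := e q D
      rw [cU] at e₁
      rw [cV] at e₂
      exact e₁.trans (h.trans e₂.symm)
    obtain ⟨g, hg⟩ := isConj_iff.1 hconj
    have hrot : C ~r D := hC.isRotated hD g.toWord isReduced_toWord (by rwa [mk_toWord])
    obtain ⟨n, hn, rfl⟩ := List.isRotated_iff_mod.1 hrot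
    rw [List.rotate_eq_drop_append_take hn] at cV
    -- U = p C p⁻¹ and V = q D q⁻¹, where D is C rotated by n. Rotating U by |p| + n and V by |q|
    -- brings p⁻¹p and q⁻¹q together, and both words become D.
    refine ⟨p.length + n, ?_, q.length, ?_, ?_⟩
    · rw [← cU]; simp; omega
    · rw [← cV]; simp
    · refine reduce.sound ?_
      rw [← cU, ← cV]
      have e₁ : (p ++ C ++ invRev p).drop (p.length + n) = C.drop n ++ invRev p := by
        rw [List.append_assoc, List.drop_append, List.drop_append]
        simp [Nat.sub_eq_zero_of_le hn]
      have e₂ : (p ++ C ++ invRev p).take (p.length + n) = p ++ C.take n := by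
        rw [List.append_assoc, List.take_append, List.take_append]
        simp [Nat.sub_eq_zero_of_le hn]
      rw [e₁, e₂]
      simp only [List.append_assoc, List.drop_left, List.take_left, mk_append, ← inv_mk]
      simp only [inv_mul_cancel_left, inv_mul_cancel, mul_one]
  · rintro ⟨i, -, j, -, h⟩
    have e₁ := isConj_mk_rotate (reduce U) i
    have e₂ := isConj_mk_rotate (reduce V) j
    rw [reduce.exact h] at e₁
    rw [reduce.self] at e₁ e₂
    exact e₁.trans e₂.symm

/-- Reduction is a right fold: a letter placed before a reduced word either cancels its head or is
prepended. -/
theorem primrec_reduce [Primcodable α] [DecidableEq α] :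
    Primrec (reduce : List (α × Bool) → List (α × Bool)) := by
  let step : (α × Bool) → List (α × Bool) → List (α × Bool) := fun x l =>
    List.casesOn l [x] fun y t => if x.1 = y.1 ∧ x.2 = !y.2 then t else x :: y :: t
  have hstep : Primrec fun q : List (α × Bool) × ((α × Bool) × List (α × Bool)) =>
      step q.2.1 q.2.2 := by
    have hx : Primrec fun q : (List (α × Bool) × ((α × Bool) × List (α × Bool))) ×
        ((α × Bool) × List (α × Bool)) => q.1.2.1 :=
      Primrec.fst.comp (Primrec.snd.comp Primrec.fst)
    have hy : Primrec fun q : (List (α × Bool) × ((α × Bool) × List (α × Bool))) ×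
        ((α × Bool) × List (α × Bool)) => q.2.1 := Primrec.fst.comp Primrec.snd
    have ht : Primrec fun q : (List (α × Bool) × ((α × Bool) × List (α × Bool))) ×
        ((α × Bool) × List (α × Bool)) => q.2.2 := Primrec.snd.comp Primrec.snd
    have hx₀ : Primrec fun q : List (α × Bool) × ((α × Bool) × List (α × Bool)) => q.2.1 :=
      Primrec.fst.comp Primrec.snd
    refine Primrec.list_casesOn (h := fun q p => if q.2.1.1 = p.1.1 ∧ q.2.1.2 = !p.1.2 then p.2
      else q.2.1 :: p.1 :: p.2) (Primrec.snd.comp Primrec.snd)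
      (Primrec.list_cons.comp hx₀ (Primrec.const [])) ?_
    refine Primrec.ite ((Primrec.eq.comp (Primrec.fst.comp hx) (Primrec.fst.comp hy)).and
      (Primrec.eq.comp (Primrec.snd.comp hx) (Primrec.not.comp (Primrec.snd.comp hy)))) ht ?_
    exact Primrec.list_cons.comp hx (Primrec.list_cons.comp hy ht)
  refine (Primrec.list_foldr Primrec.id (Primrec.const []) hstep.to₂).of_eq fun L => ?_
  induction L with
  | nil => rfl
  | cons x L ih =>
    rw [reduce.cons, ← ih]
    rfl

theorem primrec_reduce_rotate [Primcodable α] [DecidableEq α] :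
    Primrec₂ fun (i : ℕ) (L : List (α × Bool)) =>
      reduce ((reduce L).drop i ++ (reduce L).take i) := by
  have h : Primrec fun p : ℕ × List (α × Bool) => reduce p.2 := primrec_reduce.comp Primrec.snd
  have h' : Primrec fun p : ℕ × List (α × Bool) => p.1 := Primrec.fst
  have h₁ : Primrec fun p : ℕ × List (α × Bool) => (reduce p.2).drop p.1 :=
    Primrec.list_drop.comp h' h
  have h₂ : Primrec fun p : ℕ × List (α × Bool) => (reduce p.2).take p.1 :=
    Primrec.list_take.comp h' h
  exact primrec_reduce.comp (Primrec.list_append.comp h₁ h₂)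

/-- The conjugacy problem in a free group is solvable. -/
theorem primrecPred_isConj [Primcodable α] [DecidableEq α] :
    PrimrecPred fun p : List (α × Bool) × List (α × Bool) => IsConj (mk p.1) (mk p.2) := by
  have hlen : Primrec fun L : List (α × Bool) => (reduce L).length + 1 :=
    Primrec.succ.comp (Primrec.list_length.comp primrec_reduce)
  have exists_lt : ∀ {β : Type _} [Primcodable β] {R : ℕ → β → Prop}, PrimrecRel R →
      PrimrecRel fun n b => ∃ x < n, R x b := fun hR =>
    (hR.exists_mem_list.comp (Primrec.list_range.comp Primrec.fst) Primrec.snd).of_eq (by simp)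
  have h₁ : PrimrecRel fun (j : ℕ) (q : ℕ × List (α × Bool) × List (α × Bool)) =>
      reduce ((reduce q.2.1).drop q.1 ++ (reduce q.2.1).take q.1) =
        reduce ((reduce q.2.2).drop j ++ (reduce q.2.2).take j) :=
    Primrec.eq.comp
      (primrec_reduce_rotate.comp (Primrec.fst.comp Primrec.snd)
        (Primrec.fst.comp (Primrec.snd.comp Primrec.snd)))
      (primrec_reduce_rotate.comp Primrec.fst (Primrec.snd.comp (Primrec.snd.comp Primrec.snd)))
  have h₂ : PrimrecRel fun (i : ℕ) (q : List (α × Bool) × List (α × Bool)) =>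
      ∃ j < (reduce q.2).length + 1,
      reduce ((reduce q.1).drop i ++ (reduce q.1).take i) =
        reduce ((reduce q.2).drop j ++ (reduce q.2).take j) :=
    (exists_lt h₁).comp (hlen.comp (Primrec.snd.comp Primrec.snd)) Primrec.id
  have h₃ : PrimrecPred fun q : List (α × Bool) × List (α × Bool) =>
      ∃ i < (reduce q.1).length + 1, ∃ j < (reduce q.2).length + 1,
      reduce ((reduce q.1).drop i ++ (reduce q.1).take i) =
        reduce ((reduce q.2).drop j ++ (reduce q.2).take j) :=
    (exists_lt h₂).comp (hlen.comp Primrec.fst) Primrec.id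
  exact h₃.of_eq fun q => (isConj_mk_iff q.1 q.2).symm

end FreeGroup

namespace ConjProblem

/-! ### Words and elements of presented monoids -/

section Words

variable {L : Type*} (R : FreeMonoid L → FreeMonoid L → Prop)

@[simp]
theorem monoidElt_nil : monoidElt R [] = 1 := rfl

theorem monoidElt_append (U V : List L) :
    monoidElt R (U ++ V) = monoidElt R U * monoidElt R V := rfl

theorem monoidElt_cons (x : L) (U : List L) :
    monoidElt R (x :: U) = monoidElt R [x] * monoidElt R U := rfl

theorem monoidElt_surjective : Function.Surjective (monoidElt R) := fun a => by
  obtain ⟨u, rfl⟩ := PresentedMonoid.surjective_mk a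
  exact ⟨u.toList, rfl⟩

variable {R}

theorem monoidElt_eq_of_rel {U V : List L} (h : R (FreeMonoid.ofList U) (FreeMonoid.ofList V)) :
    monoidElt R U = monoidElt R V := PresentedMonoid.mk_eq_mk_of_rel h

theorem lift_monoidElt {M : Type*} [Monoid M] (f : L → M)
    (h : ∀ a b : FreeMonoid L, R a b → FreeMonoid.lift f a = FreeMonoid.lift f b) (U : List L) :
    PresentedMonoid.lift f h (monoidElt R U) = (U.map f).prod := by
  change FreeMonoid.lift f (FreeMonoid.ofList U) = _
  rw [FreeMonoid.lift_apply]
  rfl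

theorem commute_of_commute_letters {a : PresentedMonoid R}
    (h : ∀ x, Commute a (monoidElt R [x])) (b : PresentedMonoid R) : Commute a b := by
  obtain ⟨U, rfl⟩ := monoidElt_surjective R b
  induction U with
  | nil => exact Commute.one_right a
  | cons x U ih => exact (h x).mul_right ih

/-- The length of the elements of a monoid with a homogeneous presentation. -/
def lengthHom (h : ∀ a b, R a b → a.toList.length = b.toList.length) :
    PresentedMonoid R →* Multiplicative ℕ :=
  PresentedMonoid.lift (fun _ => Multiplicative.ofAdd 1) fun a b hab => by
    have e : ∀ c : FreeMonoid L, FreeMonoid.lift (fun _ => Multiplicative.ofAdd 1) c =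
        Multiplicative.ofAdd c.toList.length := fun c => by
      rw [FreeMonoid.lift_apply]
      simp [← ofAdd_nsmul]
    rw [e, e, h a b hab]

theorem lengthHom_monoidElt (h : ∀ a b, R a b → a.toList.length = b.toList.length) (U : List L) :
    lengthHom h (monoidElt R U) = Multiplicative.ofAdd U.length := by
  rw [lengthHom, lift_monoidElt]
  simp [← ofAdd_nsmul]

theorem eq_nil_of_monoidElt_eq_one (h : ∀ a b, R a b → a.toList.length = b.toList.length)
    {U : List L} (hU : monoidElt R U = 1) : U = [] := by
  have := lengthHom_monoidElt h U
  rw [hU, map_one] at this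
  exact List.length_eq_zero_iff.1 (Multiplicative.ofAdd.injective this).symm

theorem CyclicRel.length_eq {x : List L} {a b : FreeMonoid L} (h : CyclicRel x a b) :
    a.toList.length = b.toList.length := by
  obtain ⟨i, rfl, rfl⟩ := h
  exact (List.length_rotate ..).symm

end Words

/-! ### The monoid with one cyclic relation -/

section Arc

variable {m : ℕ}

/-- The word `x, x + 1, …, x + l - 1` of cyclically consecutive letters. -/
def arc : ℕ → ZMod (m + 1) → List (ZMod (m + 1))
  | 0, _ => []
  | l + 1, x => x :: arc l (x + 1)

theorem natCast_add_one_eq_zero : ((m : ℕ) : ZMod (m + 1)) + 1 = 0 := by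
  have := ZMod.natCast_self (m + 1)
  push_cast at this
  exact this

@[simp]
theorem length_arc (l : ℕ) (x : ZMod (m + 1)) : (arc l x).length = l := by
  induction l generalizing x with
  | zero => rfl
  | succ l ih => simp [arc, ih]

theorem arc_add (k l : ℕ) (x : ZMod (m + 1)) : arc (k + l) x = arc k x ++ arc l (x + (k : ZMod (m + 1))) := by
  induction k generalizing x with
  | zero => simp [arc]
  | succ k ih =>
    rw [Nat.succ_add, arc, ih, arc, List.cons_append]
    congr 3
    push_cast
    ring

theorem arc_succ_right (l : ℕ) (x : ZMod (m + 1)) : arc (l + 1) x = arc l x ++ [x + (l : ZMod (m + 1))] :=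
  arc_add l 1 x

/-- Both sides are the arc of m + 2 letters from `x`, whose last letter is again `x`. In the monoid
this becomes the centrality of the full cycle. -/
theorem arc_cycle_append (x : ZMod (m + 1)) : arc (m + 1) x ++ [x] = x :: arc (m + 1) (x + 1) := by
  change _ = arc (m + 1 + 1) x
  rw [arc_succ_right (m + 1)]
  congr 2
  push_cast
  rw [natCast_add_one_eq_zero, add_zero]

theorem rotate_arc_cycle (i : ℕ) (x : ZMod (m + 1)) :
    (arc (m + 1) x).rotate i = arc (m + 1) (x + (i : ZMod (m + 1))) := by
  induction i with
  | zero => simp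
  | succ i ih =>
    rw [← List.rotate_rotate, ih]
    have := arc_cycle_append (x + (i : ZMod (m + 1)))
    rw [arc, List.cons_append, List.cons.injEq] at this
    rw [arc, List.rotate_cons_succ, List.rotate_zero, this.2]
    congr 1
    push_cast
    ring

theorem arc_prefix {k l : ℕ} (h : k ≤ l) (x : ZMod (m + 1)) : arc k x <+: arc l x := by
  obtain ⟨d, rfl⟩ := Nat.exists_eq_add_of_le h
  exact ⟨_, (arc_add k d x).symm⟩

theorem head?_of_arc_prefix {p q : ℕ} (h : q < p) {x : ZMod (m + 1)} {v : List (ZMod (m + 1))}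
    (hp : arc p x <+: arc q x ++ v) : v.head? = some (x + (q : ZMod (m + 1))) := by
  obtain ⟨d, rfl⟩ := Nat.exists_eq_add_of_lt h
  rw [add_assoc, arc_add, List.prefix_append_right_inj] at hp
  obtain ⟨w, rfl⟩ := hp
  rfl

/-- Every word has a longest prefix of consecutive letters starting with `x`. -/
theorem exists_eq_arc_append (x : ZMod (m + 1)) (v : List (ZMod (m + 1))) :
    ∃ l v', v = arc l x ++ v' ∧ v'.head? ≠ some (x + (l : ZMod (m + 1))) := by
  induction v generalizing x with
  | nil => exact ⟨0, [], rfl, by simp⟩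
  | cons y v ih =>
    by_cases h : y = x
    · obtain ⟨l, v', rfl, hv'⟩ := ih (x + 1)
      refine ⟨l + 1, v', by rw [h]; rfl, ?_⟩
      rwa [Nat.cast_succ, add_comm (l : ZMod (m + 1)), ← add_assoc]
    · exact ⟨0, y :: v, rfl, by simpa using h⟩

/-- A word is reduced if it contains no full cycle of consecutive letters. -/
def Reduced (v : List (ZMod (m + 1))) : Prop := ∀ x, ¬ arc (m + 1) x <:+: v

theorem Reduced.infix {u v : List (ZMod (m + 1))} (hv : Reduced v) (h : u <:+: v) : Reduced u :=
  fun x hx => hv x (hx.trans h)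

theorem reduced_nil : Reduced ([] : List (ZMod (m + 1))) := fun x hx => by
  simp [arc] at hx

/-- A full cycle created by prepending a letter has to start at that letter. -/
theorem Reduced.cons {x : ZMod (m + 1)} {v : List (ZMod (m + 1))} (hv : Reduced v)
    (h : ¬ arc m (x + 1) <+: v) : Reduced (x :: v) := fun y hy => by
  rcases List.infix_cons_iff.1 hy with hy | hy
  · rw [arc, List.cons_prefix_cons] at hy
    exact h (hy.1 ▸ hy.2)
  · exact hv y hy

theorem Reduced.not_prefix {x : ZMod (m + 1)} {v : List (ZMod (m + 1))} (h : Reduced (x :: v)) :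
    ¬ arc m (x + 1) <+: v := fun h' =>
  h x (List.IsPrefix.isInfix (List.cons_prefix_cons.2 ⟨rfl, h'⟩))

theorem Reduced.le_of_arc_prefix {l : ℕ} {x : ZMod (m + 1)} {v : List (ZMod (m + 1))}
    (h : Reduced v) (hl : arc l x <+: v) : l ≤ m := by
  by_contra! hlt
  exact h x ((arc_prefix hlt x).trans hl).isInfix

end Arc

/-- The relation `[x_0, …, x_m]`. -/
abbrev CycleRel (m : ℕ) : FreeMonoid (ZMod (m + 1)) → FreeMonoid (ZMod (m + 1)) → Prop :=
  CyclicRel (arc (m + 1) 0)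

/-- The monoid with generators `x_0, …, x_m` and defining relations `[x_0, …, x_m]`. -/
abbrev CycleMonoid (m : ℕ) : Type := PresentedMonoid (CycleRel m)

section CycleMonoid

variable {m : ℕ}

local notation "⟪" U "⟫" => monoidElt (CycleRel m) U

/-- The element `x_0 ⋯ x_m`. -/
def cycleElt (m : ℕ) : CycleMonoid m := monoidElt (CycleRel m) (arc (m + 1) 0)

theorem CycleRel.length_eq (a b : FreeMonoid (ZMod (m + 1))) (h : CycleRel m a b) :
    a.toList.length = b.toList.length := CyclicRel.length_eq h

theorem monoidElt_arc_cycle (x : ZMod (m + 1)) : ⟪arc (m + 1) x⟫ = cycleElt m := by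
  refine (monoidElt_eq_of_rel ⟨x.val, rfl, ?_⟩).symm
  rw [rotate_arc_cycle, zero_add, ZMod.natCast_zmod_val]

theorem cycleElt_commute (a : CycleMonoid m) : Commute (cycleElt m) a := by
  refine commute_of_commute_letters (fun x => ?_) a
  have := congrArg (monoidElt (CycleRel m)) (arc_cycle_append x)
  rwa [monoidElt_append, monoidElt_cons _ x (arc _ _), monoidElt_arc_cycle,
    monoidElt_arc_cycle] at this

theorem cycleElt_dvd_of_infix {x : ZMod (m + 1)} {v : List (ZMod (m + 1))}
    (h : arc (m + 1) x <:+: v) : ∃ v', v'.length < v.length ∧ ⟪v⟫ = cycleElt m * ⟪v'⟫ := by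
  obtain ⟨p, q, rfl⟩ := h
  refine ⟨p ++ q, by simp, ?_⟩
  rw [monoidElt_append, monoidElt_append, monoidElt_append, monoidElt_arc_cycle,
    ← (cycleElt_commute _).eq, mul_assoc]

theorem exists_eq_pow_mul_reduced (a : CycleMonoid m) :
    ∃ k v, Reduced v ∧ a = cycleElt m ^ k * ⟪v⟫ := by
  obtain ⟨u, rfl⟩ := monoidElt_surjective _ a
  induction hn : u.length using Nat.strong_induction_on generalizing u with
  | _ n ih =>
    by_cases hu : Reduced u
    · exact ⟨0, u, hu, by simp⟩
    · obtain ⟨x, hx⟩ : ∃ x, arc (m + 1) x <:+: u := by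
        simpa [Reduced] using hu
      obtain ⟨u', hlt, he⟩ := cycleElt_dvd_of_infix hx
      obtain ⟨k, v, hv, hk⟩ := ih _ (hn ▸ hlt) u' rfl
      exact ⟨k + 1, v, hv, by rw [he, hk, pow_succ', mul_assoc]⟩

/-- A reduced word is the only word that represents its element. -/
theorem Reduced.eq_of_monoidElt_eq {u v : List (ZMod (m + 1))} (hv : Reduced v)
    (h : ⟪u⟫ = ⟪v⟫) : u = v := by
  -- Both sides of a defining relation are full cycles, so no relation applies inside a reduced
  -- word. The claim is made for both sides so that it survives symmetry and transitivity.
  suffices H : ∀ a b : FreeMonoid (ZMod (m + 1)), ConGen.Rel (CycleRel m) a b →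
      (Reduced a.toList → a = b) ∧ (Reduced b.toList → a = b) from
    (H (FreeMonoid.ofList u) (FreeMonoid.ofList v) (PresentedMonoid.mk_eq_mk_iff.1 h)).2 hv
  intro a b hab
  induction hab with
  | of a b h =>
    obtain ⟨i, rfl, rfl⟩ := h
    refine ⟨fun h => (h _ List.infix_rfl).elim, fun h => ?_⟩
    rw [rotate_arc_cycle] at h
    exact (h _ List.infix_rfl).elim
  | refl a => exact ⟨fun _ => rfl, fun _ => rfl⟩
  | symm _ ih => exact ⟨fun h => (ih.2 h).symm, fun h => (ih.1 h).symm⟩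
  | trans _ _ ih₁ ih₂ =>
    refine ⟨fun h => ?_, fun h => ?_⟩
    · have e := ih₁.1 h
      exact e.trans (ih₂.1 (e ▸ h))
    · have e := ih₂.2 h
      exact (ih₁.2 (e ▸ h)).trans e
  | mul _ _ ih₁ ih₂ =>
    refine ⟨fun h => ?_, fun h => ?_⟩ <;> rw [FreeMonoid.toList_mul] at h
    · rw [ih₁.1 (h.infix (List.prefix_append _ _).isInfix),
        ih₂.1 (h.infix (List.suffix_append _ _).isInfix)]
    · rw [ih₁.2 (h.infix (List.prefix_append _ _).isInfix),
        ih₂.2 (h.infix (List.suffix_append _ _).isInfix)]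

/-- Every transit element of `w` is divisible by a transit element of `w` that divides
`x_0 ⋯ x_m`. -/
theorem exists_transit_dvd_cycleElt {w A : CycleMonoid m} (hA : A ≠ 1) (h : A ∣ w * A) :
    ∃ δ, δ ≠ 1 ∧ δ ∣ A ∧ δ ∣ cycleElt m ∧ δ ∣ w * δ := by
  have hc : ∀ a : CycleMonoid m, cycleElt m ∣ a * cycleElt m := fun a =>
    ⟨a, (cycleElt_commute a).eq.symm⟩
  obtain ⟨k, v, hv, rfl⟩ := exists_eq_pow_mul_reduced A
  rcases k with - | k
  swap
  -- If the full cycle divides A, it is itself a transit element, being central.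
  · refine ⟨cycleElt m, fun h => ?_, ?_, dvd_rfl, hc w⟩
    · exact absurd (eq_nil_of_monoidElt_eq_one CycleRel.length_eq h) (by simp [arc])
    · rw [pow_succ', mul_assoc]
      exact dvd_mul_right _ _
  rw [pow_zero, one_mul] at *
  rcases v with - | ⟨x, v₁⟩
  · exact absurd rfl hA
  -- Otherwise A is a reduced word, and its longest initial arc is the required δ.
  obtain ⟨l, v', hl, hv'⟩ := exists_eq_arc_append x (x :: v₁)
  have hlm : l ≤ m := hv.le_of_arc_prefix ⟨v', hl.symm⟩
  have hl0 : l ≠ 0 := by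
    rintro rfl
    rw [arc, List.nil_append] at hl
    rw [← hl] at hv'
    simp at hv'
  have hδc : ⟪arc l x⟫ ∣ cycleElt m := by
    obtain ⟨q, hq⟩ := arc_prefix (Nat.le_succ_of_le hlm) x
    rw [← monoidElt_arc_cycle x, ← hq]
    exact ⟨_, monoidElt_append _ _ _⟩
  refine ⟨⟪arc l x⟫, fun h => ?_, ⟨⟪v'⟫, by rw [hl, monoidElt_append]⟩, hδc, ?_⟩
  · have := congrArg List.length (eq_nil_of_monoidElt_eq_one CycleRel.length_eq h)
    simp at this
    exact hl0 this
  obtain ⟨k, u, hu, rfl⟩ := exists_eq_pow_mul_reduced w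
  rcases k with - | k
  swap
  -- If the full cycle divides w, then it divides w δ, and δ divides the cycle.
  · refine hδc.trans ?_
    rw [pow_succ', mul_assoc, mul_assoc]
    exact dvd_mul_right _ _
  rw [pow_zero, one_mul] at *
  rw [← monoidElt_append]
  -- If the product w A is a reduced word, it has no other spelling, so A is literally a prefix of
  -- it; comparing lengths, δ is a prefix of w δ. If not, a full cycle occurs, and it suffices to
  -- find it within w δ.
  by_cases hr : Reduced (u ++ x :: v₁)
  · obtain ⟨r, hr'⟩ := h
    obtain ⟨r, rfl⟩ := monoidElt_surjective _ r
    rw [← monoidElt_append, ← monoidElt_append] at hr'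
    have he := hr.eq_of_monoidElt_eq hr'.symm
    rw [hl, ← List.append_assoc] at he
    have h₁ : arc l x <+: (u ++ arc l x) ++ v' := ⟨v' ++ r, by rw [← List.append_assoc, he]⟩
    obtain ⟨q, hq⟩ := List.prefix_of_prefix_length_le h₁ (List.prefix_append _ _) (by simp)
    exact ⟨⟪q⟫, by rw [← hq, monoidElt_append]⟩
  · obtain ⟨y, hy⟩ : ∃ y, arc (m + 1) y <:+: u ++ x :: v₁ := by
      simpa [Reduced] using hr
    suffices hy' : arc (m + 1) y <:+: u ++ arc l x by
      obtain ⟨q, -, hq⟩ := cycleElt_dvd_of_infix hy'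
      exact hδc.trans ⟨_, hq⟩
    rcases List.infix_append_iff.1 hy with hy | hy | ⟨l₁, l₂, he, h₁, h₂⟩
    · exact absurd hy (hu y)
    · exact absurd hy (hv y)
    -- The cycle straddles the junction. Its part inside A is an arc from the first letter of A, so
    -- maximality of `l` confines it to δ.
    · have h₃ : l₂ <+: arc l x := by
        rcases l₂ with - | ⟨z, l₂⟩
        · exact List.nil_prefix
        have hlen := congrArg List.length he
        rw [length_arc, List.length_append] at hlen
        have hadd := arc_add l₁.length (z :: l₂).length y
        rw [← hlen] at hadd
        rw [hadd] at he
        obtain ⟨-, he⟩ := List.append_inj he (by simp)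
        rw [List.length_cons, arc] at he
        have hz : z = x := by
          rw [List.cons_prefix_cons] at h₂
          exact h₂.1
        have hz' : z :: l₂ = arc (l₂.length + 1) x := by
          rw [← he, arc, ← hz, (List.cons.inj he).1]
        rw [hz'] at h₂ ⊢
        rw [hl] at h₂
        refine arc_prefix ?_ x
        by_contra! hlt
        exact hv' (head?_of_arc_prefix hlt h₂)
      obtain ⟨p, rfl⟩ := h₁
      obtain ⟨q, hq⟩ := h₃
      exact ⟨p, q, by rw [he, ← hq]; simp⟩

/-! ### The action on normal forms -/

/-- Normal forms: an exponent of `x_0 ⋯ x_m` and a reduced word. -/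
abbrev NormalForm (m : ℕ) : Type := ℤ × {v : List (ZMod (m + 1)) // Reduced v}

/-- The multiplication of a normal form by a letter. -/
def letterAct (x : ZMod (m + 1)) (p : NormalForm m) : NormalForm m :=
  -- Here `x` completes a full cycle, which is traded for one unit of the exponent.
  if h : arc m (x + 1) <+: p.2.1 then
    (p.1 + 1, ⟨p.2.1.drop m, p.2.2.infix (List.drop_suffix _ _).isInfix⟩)
  else (p.1, ⟨x :: p.2.1, p.2.2.cons h⟩)

/-- The multiplication of a normal form by a word. -/
def wordAct (u : List (ZMod (m + 1))) (p : NormalForm m) : NormalForm m := u.foldr letterAct p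

/-- The multiplication of a normal form by a power of `x_0 ⋯ x_m`. -/
def shift (j : ℤ) (p : NormalForm m) : NormalForm m := (p.1 + j, p.2)

theorem wordAct_append (u v : List (ZMod (m + 1))) (p : NormalForm m) :
    wordAct (u ++ v) p = wordAct u (wordAct v p) := List.foldr_append

theorem letterAct_shift (x : ZMod (m + 1)) (j : ℤ) (p : NormalForm m) :
    letterAct x (shift j p) = shift j (letterAct x p) := by
  by_cases h : arc m (x + 1) <+: p.2.1
  · have h' : arc m (x + 1) <+: (shift j p).2.1 := h
    rw [letterAct, dif_pos h', letterAct, dif_pos h]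
    exact Prod.ext (add_right_comm _ _ _) rfl
  · have h' : ¬ arc m (x + 1) <+: (shift j p).2.1 := h
    rw [letterAct, dif_neg h', letterAct, dif_neg h]
    rfl

/-- No cycle is completed on the way: the arc in front has too few letters, and `v` does not
continue it. Hence every letter is simply prepended. -/
theorem wordAct_arc {j l : ℕ} {y : ZMod (m + 1)} {v : List (ZMod (m + 1))} (hl : l + j ≤ m)
    (hv : v.head? ≠ some (y + ((l + j : ℕ) : ZMod (m + 1)))) {p : NormalForm m}
    (hp : p.2.1 = arc j (y + (l : ZMod (m + 1))) ++ v) :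
    (wordAct (arc l y) p).1 = p.1 ∧ (wordAct (arc l y) p).2.1 = arc (l + j) y ++ v := by
  induction l generalizing y with
  | zero => simpa [wordAct, arc] using hp
  | succ l ih =>
    have e : y + 1 + ((l + j : ℕ) : ZMod (m + 1)) = y + ((l + 1 + j : ℕ) : ZMod (m + 1)) := by
      push_cast
      ring
    obtain ⟨h₁, h₂⟩ := ih (y := y + 1) (by omega) (by rwa [e]) (by
      rw [hp]
      congr 2
      push_cast
      ring)
    have h₃ : ¬ arc m (y + 1) <+: (wordAct (arc l (y + 1)) p).2.1 := fun h => by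
      rw [h₂] at h
      have := head?_of_arc_prefix (by omega) h
      rw [e] at this
      exact hv this
    change (letterAct y (wordAct (arc l (y + 1)) p)).1 = _ ∧
      (letterAct y (wordAct (arc l (y + 1)) p)).2.1 = _
    rw [letterAct, dif_neg h₃]
    refine ⟨h₁, ?_⟩
    rw [Nat.succ_add, arc, List.cons_append, ← h₂]

/-- Let `p` begin with a maximal arc of `j` letters from `x`, and m = j + d. The last `d` letters
extend that arc to `m` letters, the letter x + j completes the cycle and removes it, and the first
`j` letters restore the original arc. -/
theorem wordAct_arc_cycle (x : ZMod (m + 1)) (p : NormalForm m) :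
    wordAct (arc (m + 1) x) p = shift 1 p := by
  obtain ⟨j, v, hp, hv⟩ := exists_eq_arc_append x p.2.1
  have hj : j ≤ m := p.2.2.le_of_arc_prefix ⟨v, hp.symm⟩
  obtain ⟨d, hd⟩ := Nat.exists_eq_add_of_le hj
  have hcyc : (j : ZMod (m + 1)) + d + 1 = 0 := by
    rw [← natCast_add_one_eq_zero (m := m), ← Nat.cast_add, ← hd]
  set y : ZMod (m + 1) := x + j with hy
  have hvr : Reduced v := p.2.2.infix (by rw [hp]; exact (List.suffix_append _ _).isInfix)
  obtain ⟨h₁, h₂⟩ := wordAct_arc (j := j) (l := d) (y := y + 1) (v := v) (p := p) (by omega)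
    (by
      convert hv using 2
      push_cast
      linear_combination hcyc)
    (by
      rw [hp]
      congr 2
      linear_combination -hcyc - hy)
  rw [add_comm d j, ← hd] at h₂
  have h₃ : letterAct y (wordAct (arc d (y + 1)) p) = (p.1 + 1, ⟨v, hvr⟩) := by
    rw [letterAct, dif_pos (by rw [h₂]; exact List.prefix_append _ _), h₁]
    congr 2
    rw [h₂, List.drop_left' (length_arc _ _)]
  obtain ⟨h₄, h₅⟩ := wordAct_arc (j := 0) (l := j) (y := x) (v := v) (p := (p.1 + 1, ⟨v, hvr⟩))
    (by omega) hv rfl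
  have e : arc (m + 1) x = arc j x ++ y :: arc d (y + 1) := by
    have := arc_add j (d + 1) x
    rwa [← add_assoc, ← hd] at this
  rw [e, wordAct_append]
  change wordAct (arc j x) (letterAct y (wordAct (arc d (y + 1)) p)) = _
  rw [h₃]
  exact Prod.ext h₄ (Subtype.ext (h₅.trans hp.symm))

/-- The multiplication by a letter as a permutation of the normal forms. -/
def letterPerm (x : ZMod (m + 1)) : Equiv.Perm (NormalForm m) where
  toFun := letterAct x
  -- The rest of the cycle, divided by the full cycle, inverts `x`; this is why exponents range over
  -- ℤ.
  invFun p := shift (-1) (wordAct (arc m (x + 1)) p)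
  left_inv p := by
    have e : arc (m + 1) (x + 1) = arc m (x + 1) ++ [x] := by
      have := arc_cycle_append x
      rw [arc, List.cons_append, List.cons.injEq] at this
      exact this.2.symm
    have := wordAct_arc_cycle (x + 1) p
    rw [e, wordAct_append] at this
    change shift (-1) (wordAct (arc m (x + 1)) (wordAct [x] p)) = p
    rw [this]
    simp [shift]
  right_inv p := by
    have := wordAct_arc_cycle x p
    rw [letterAct_shift]
    change shift (-1) (wordAct (arc (m + 1) x) p) = p
    rw [this]
    simp [shift]

theorem prod_letterPerm (u : List (ZMod (m + 1))) (p : NormalForm m) :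
    (u.map letterPerm).prod p = wordAct u p := by
  induction u with
  | nil => rfl
  | cons x u ih =>
    rw [List.map_cons, List.prod_cons, Equiv.Perm.mul_apply, ih]
    rfl

/-- The action of the monoid on normal forms. -/
def actHom (m : ℕ) : CycleMonoid m →* Equiv.Perm (NormalForm m) :=
  PresentedMonoid.lift letterPerm fun a b h => by
    obtain ⟨i, rfl, rfl⟩ := h
    rw [rotate_arc_cycle]
    ext1 p
    rw [FreeMonoid.lift_apply, FreeMonoid.lift_apply, FreeMonoid.toList_ofList,
      FreeMonoid.toList_ofList, prod_letterPerm, prod_letterPerm, wordAct_arc_cycle,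
      wordAct_arc_cycle]

theorem actHom_monoidElt (u : List (ZMod (m + 1))) (p : NormalForm m) :
    actHom m ⟪u⟫ p = wordAct u p := by
  rw [actHom, lift_monoidElt, prod_letterPerm]

theorem wordAct_reduced {v : List (ZMod (m + 1))} (hv : Reduced v) (k : ℤ) :
    wordAct v (k, ⟨[], reduced_nil⟩) = (k, ⟨v, hv⟩) := by
  induction v with
  | nil => rfl
  | cons x v ih =>
    change letterAct x (wordAct v _) = _
    rw [ih (hv.infix (List.suffix_cons _ _).isInfix), letterAct, dif_neg hv.not_prefix]

theorem actHom_cycleElt_pow (k : ℕ) (p : NormalForm m) :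
    actHom m (cycleElt m ^ k) p = shift k p := by
  induction k with
  | zero => simp [shift]
  | succ k ih =>
    rw [pow_succ', map_mul, Equiv.Perm.mul_apply, ih, cycleElt, actHom_monoidElt,
      wordAct_arc_cycle]
    simp [shift, add_assoc]

/-- Acting on the empty normal form returns the exponent and the reduced word. -/
theorem actHom_injective : Function.Injective (actHom m) := by
  intro a b hab
  obtain ⟨k, u, hu, rfl⟩ := exists_eq_pow_mul_reduced a
  obtain ⟨l, v, hv, rfl⟩ := exists_eq_pow_mul_reduced b
  have h := DFunLike.congr_fun hab (0, ⟨[], reduced_nil⟩)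
  rw [map_mul, map_mul, Equiv.Perm.mul_apply, Equiv.Perm.mul_apply, actHom_cycleElt_pow,
    actHom_cycleElt_pow, actHom_monoidElt, actHom_monoidElt, wordAct_reduced hu,
    wordAct_reduced hv] at h
  simp only [shift, zero_add, Prod.mk.injEq, Nat.cast_inj, Subtype.mk.injEq] at h
  rw [h.1, h.2]

end CycleMonoid

end ConjProblem

namespace ConjProblem

/-! ### The exponent of `x_0` -/

section CountHom

variable {m : ℕ}

theorem mem_arc {l : ℕ} {x y : ZMod (m + 1)} :
    y ∈ arc l x ↔ ∃ j < l, y = x + (j : ZMod (m + 1)) := by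
  induction l generalizing x with
  | zero => simp [arc]
  | succ l ih =>
    rw [arc, List.mem_cons, ih]
    constructor
    · rintro (rfl | ⟨j, hj, rfl⟩)
      · exact ⟨0, by omega, by simp⟩
      · exact ⟨j + 1, by omega, by push_cast; ring⟩
    · rintro ⟨j, hj, rfl⟩
      rcases j with - | j
      · exact Or.inl (by simp)
      · exact Or.inr ⟨j, by omega, by push_cast; ring⟩

theorem count_arc_cycle (x : ZMod (m + 1)) : (arc (m + 1) x).count 0 = 1 := by
  have h : (arc (m + 1) x).Perm (arc (m + 1) 0) := by
    have := rotate_arc_cycle x.val (0 : ZMod (m + 1))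
    rw [zero_add, ZMod.natCast_zmod_val] at this
    exact this ▸ List.rotate_perm _ _
  rw [h.count_eq, arc, List.count_cons_self, List.count_eq_zero.2]
  rw [mem_arc]
  rintro ⟨j, hj, h⟩
  have h' : ((1 + j : ℕ) : ZMod (m + 1)) = 0 := by
    rw [h]
    push_cast
    ring
  have := Nat.le_of_dvd (by omega) ((ZMod.natCast_eq_zero_iff _ _).1 h')
  omega

theorem prod_map_ite {N : Type*} [Monoid N] (a : N) (l : List (ZMod (m + 1))) :
    (l.map fun x => if x = 0 then a else 1).prod = a ^ l.count 0 := by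
  induction l with
  | nil => simp
  | cons x l ih =>
    rw [List.map_cons, List.prod_cons, ih]
    by_cases hx : x = 0
    · subst hx
      rw [if_pos rfl, List.count_cons_self, pow_succ']
    · rw [if_neg hx, one_mul, List.count_cons_of_ne hx]

/-- The exponent of `x_0`. -/
def countHom (m : ℕ) : CycleMonoid m →* Multiplicative ℕ :=
  PresentedMonoid.lift (fun x => if x = 0 then Multiplicative.ofAdd 1 else 1) fun a b h => by
    obtain ⟨i, rfl, rfl⟩ := h
    rw [rotate_arc_cycle, FreeMonoid.lift_apply, FreeMonoid.lift_apply, FreeMonoid.toList_ofList,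
      FreeMonoid.toList_ofList, prod_map_ite, prod_map_ite, count_arc_cycle, count_arc_cycle]

theorem countHom_monoidElt (u : List (ZMod (m + 1))) :
    countHom m (monoidElt (CycleRel m) u) = Multiplicative.ofAdd (u.count 0) := by
  rw [countHom, lift_monoidElt, prod_map_ite, ← ofAdd_nsmul, smul_eq_mul, mul_one]

end CountHom

/-! ### Indexing the letters by the two cycles -/

section Letters

variable {m n : ℕ}

/-- The letters `s, t_1, …, t_m`. -/
def tLetter (x : ZMod (m + 1)) : Gen m n :=
  Fin.cases (motive := fun _ => Gen m n) Gen.s Gen.t (x : Fin (m + 1))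

/-- The letters `s, u_1, …, u_n`. -/
def uLetter (y : ZMod (n + 1)) : Gen m n :=
  Fin.cases (motive := fun _ => Gen m n) Gen.s Gen.u (y : Fin (n + 1))

/-- The index of `t_i` in the cycle `s, t_1, …, t_m`. -/
def succIndex (i : Fin m) : ZMod (m + 1) := Fin.succ i

theorem tLetter_zero : (tLetter 0 : Gen m n) = Gen.s := rfl

theorem uLetter_zero : (uLetter 0 : Gen m n) = Gen.s := rfl

theorem succIndex_ne_zero (i : Fin m) : succIndex i ≠ 0 := Fin.succ_ne_zero i

theorem eq_succIndex {x : ZMod (m + 1)} (hx : x ≠ 0) : ∃ i, x = succIndex i :=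
  ⟨Fin.pred x hx, (Fin.succ_pred x hx).symm⟩

theorem arc_eq_ofFn (l : ℕ) (x : ZMod (m + 1)) :
    arc l x = List.ofFn fun i : Fin l => x + ((i : ℕ) : ZMod (m + 1)) := by
  induction l generalizing x with
  | zero => rfl
  | succ l ih =>
    rw [arc, ih, List.ofFn_succ]
    congr 1
    · simp
    · congr 1
      ext1 i
      push_cast [Fin.val_succ]
      ring

theorem arc_eq_ofFn_succIndex : arc m 1 = List.ofFn (succIndex : Fin m → ZMod (m + 1)) := by
  rw [arc_eq_ofFn]
  congr 1
  ext1 i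
  have h := ZMod.natCast_zmod_val (succIndex i)
  rw [← h]
  change _ = (((i : ℕ) + 1 : ℕ) : ZMod (m + 1))
  push_cast
  ring

theorem map_tLetter_arc : (arc (m + 1) 0).map (tLetter : _ → Gen m n) = Gen.s :: tWord m n := by
  rw [arc, zero_add, arc_eq_ofFn_succIndex, List.map_cons, List.map_ofFn]
  rfl

theorem map_uLetter_arc : (arc (n + 1) 0).map (uLetter : _ → Gen m n) = Gen.s :: uWord m n := by
  rw [arc, zero_add, arc_eq_ofFn_succIndex, List.map_cons, List.map_ofFn]
  rfl

theorem rotate_pair {α : Type*} (x y : α) (i : ℕ) :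
    [x, y].rotate i = [x, y] ∨ [x, y].rotate i = [y, x] := by
  induction i with
  | zero => exact Or.inl rfl
  | succ i ih =>
    rw [← List.rotate_rotate]
    rcases ih with h | h <;> rw [h]
    · exact Or.inr rfl
    · exact Or.inl rfl

/-- Rotations become arcs with a different starting point. The reflexive case is present because a
rotation of a pair may be trivial. -/
theorem GRel.elim {P : List (Gen m n) → List (Gen m n) → Prop}
    (hT : ∀ x, P ((arc (m + 1) 0).map tLetter) ((arc (m + 1) x).map tLetter))
    (hU : ∀ y, P ((arc (n + 1) 0).map uLetter) ((arc (n + 1) y).map uLetter))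
    (hrefl : ∀ i j, P [Gen.t i, Gen.u j] [Gen.t i, Gen.u j])
    (hcomm : ∀ i j, P [Gen.t i, Gen.u j] [Gen.u j, Gen.t i])
    {a b : FreeMonoid (Gen m n)} (h : GRel m n a b) : P a.toList b.toList := by
  rcases h with ⟨k, rfl, rfl⟩ | ⟨k, rfl, rfl⟩ | ⟨i, j, k, rfl, rfl⟩ <;>
    simp only [FreeMonoid.toList_ofList]
  · rw [← map_tLetter_arc, ← List.map_rotate, rotate_arc_cycle]
    exact hT _
  · rw [← map_uLetter_arc, ← List.map_rotate, rotate_arc_cycle]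
    exact hU _
  · rcases rotate_pair (Gen.t i : Gen m n) (Gen.u j) k with h | h <;> rw [h]
    · exact hrefl i j
    · exact hcomm i j

/-- A map on the letters respects the relations if it respects the cyclic relations. -/
theorem lift_eq_of_gRel {N : Type*} [Monoid N] (f : Gen m n → N)
    (hT : ∀ x, ((arc (m + 1) 0).map fun x => f (tLetter x)).prod =
      ((arc (m + 1) x).map fun x => f (tLetter x)).prod)
    (hU : ∀ y, ((arc (n + 1) 0).map fun y => f (uLetter y)).prod =
      ((arc (n + 1) y).map fun y => f (uLetter y)).prod)
    (hcomm : ∀ i j, f (Gen.t i) * f (Gen.u j) = f (Gen.u j) * f (Gen.t i))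
    (a b : FreeMonoid (Gen m n)) (h : GRel m n a b) :
    FreeMonoid.lift f a = FreeMonoid.lift f b := by
  rw [FreeMonoid.lift_apply, FreeMonoid.lift_apply]
  refine h.elim (P := fun a b => (a.map f).prod = (b.map f).prod) ?_ ?_ ?_ ?_
  · simpa [Function.comp_def] using hT
  · simpa [Function.comp_def] using hU
  · simp
  · simpa using hcomm

theorem GRel.length_eq (a b : FreeMonoid (Gen m n)) (h : GRel m n a b) :
    a.toList.length = b.toList.length := by
  rcases h with h | h | ⟨i, j, h⟩ <;> exact h.length_eq

theorem monoidElt_map_tLetter (x : ZMod (m + 1)) :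
    monoidElt (GRel m n) ((arc (m + 1) x).map tLetter) =
      monoidElt (GRel m n) ((arc (m + 1) 0).map tLetter) := by
  refine (monoidElt_eq_of_rel (Or.inl ⟨x.val, ?_, ?_⟩)).symm
  · rw [map_tLetter_arc]
  · rw [← map_tLetter_arc, ← List.map_rotate, rotate_arc_cycle, zero_add, ZMod.natCast_zmod_val]

theorem monoidElt_map_uLetter (y : ZMod (n + 1)) :
    monoidElt (GRel m n) ((arc (n + 1) y).map uLetter) =
      monoidElt (GRel m n) ((arc (n + 1) 0).map uLetter) := by
  refine (monoidElt_eq_of_rel (Or.inr (Or.inl ⟨y.val, ?_, ?_⟩))).symm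
  · rw [map_uLetter_arc]
  · rw [← map_uLetter_arc, ← List.map_rotate, rotate_arc_cycle, zero_add, ZMod.natCast_zmod_val]

theorem letter_commute {x : ZMod (m + 1)} {y : ZMod (n + 1)} (hx : x ≠ 0) (hy : y ≠ 0) :
    Commute (letter (tLetter x : Gen m n)) (letter (uLetter y)) := by
  obtain ⟨i, rfl⟩ := eq_succIndex hx
  obtain ⟨j, rfl⟩ := eq_succIndex hy
  exact monoidElt_eq_of_rel (U := [Gen.t i, Gen.u j]) (V := [Gen.u j, Gen.t i])
    (Or.inr (Or.inr ⟨i, j, 1, rfl, rfl⟩))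

end Letters

/-! ### The two projections -/

section Projections

variable {m n : ℕ}

/-- The subword of a letter in the letters `s, t_1, …, t_m`. -/
def tPart : Gen m n → List (ZMod (m + 1))
  | Sum.inl _ => [0]
  | Sum.inr (Sum.inl i) => [succIndex i]
  | Sum.inr (Sum.inr _) => []

/-- The subword of a letter in the letters `s, u_1, …, u_n`. -/
def uPart : Gen m n → List (ZMod (n + 1))
  | Sum.inl _ => [0]
  | Sum.inr (Sum.inl _) => []
  | Sum.inr (Sum.inr j) => [succIndex j]

theorem tPart_tLetter (x : ZMod (m + 1)) : tPart (tLetter x : Gen m n) = [x] := by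
  by_cases hx : x = 0
  · subst hx; rfl
  · obtain ⟨i, rfl⟩ := eq_succIndex hx; rfl

theorem uPart_uLetter (y : ZMod (n + 1)) : uPart (uLetter y : Gen m n) = [y] := by
  by_cases hy : y = 0
  · subst hy; rfl
  · obtain ⟨i, rfl⟩ := eq_succIndex hy; rfl

theorem tPart_uLetter (y : ZMod (n + 1)) :
    tPart (uLetter y : Gen m n) = if y = 0 then [0] else [] := by
  by_cases hy : y = 0
  · subst hy; rfl
  · rw [if_neg hy]
    obtain ⟨i, rfl⟩ := eq_succIndex hy; rfl

theorem uPart_tLetter (x : ZMod (m + 1)) :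
    uPart (tLetter x : Gen m n) = if x = 0 then [0] else [] := by
  by_cases hx : x = 0
  · subst hx; rfl
  · rw [if_neg hx]
    obtain ⟨i, rfl⟩ := eq_succIndex hx; rfl

theorem prod_map_monoidElt {L : Type*} {R : FreeMonoid L → FreeMonoid L → Prop} {K : Type*}
    (f : K → List L) (U : List K) :
    (U.map fun x => monoidElt R (f x)).prod = monoidElt R (U.flatMap f) := by
  induction U with
  | nil => rfl
  | cons x U ih => rw [List.map_cons, List.prod_cons, ih, List.flatMap_cons, monoidElt_append]

/-- The projection that deletes the letters `u_j`. -/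
def tProj (m n : ℕ) : GPlus m n →* CycleMonoid m :=
  PresentedMonoid.lift (fun g => monoidElt (CycleRel m) (tPart g)) <| by
    refine lift_eq_of_gRel _ (fun x => ?_) (fun y => ?_) fun i j => ?_
    · simp only [tPart_tLetter, prod_map_monoidElt, List.flatMap_singleton', monoidElt_arc_cycle]
    -- Once the u_j are deleted, each rotation of the cycle s, u_1, …, u_n leaves a single s.
    · simp only [tPart_uLetter, apply_ite (monoidElt (CycleRel m)), monoidElt_nil, prod_map_ite,
        count_arc_cycle]
    · simp [tPart, Gen.t, Gen.u]

/-- The projection that deletes the letters `t_i`. -/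
def uProj (m n : ℕ) : GPlus m n →* CycleMonoid n :=
  PresentedMonoid.lift (fun g => monoidElt (CycleRel n) (uPart g)) <| by
    refine lift_eq_of_gRel _ (fun x => ?_) (fun y => ?_) fun i j => ?_
    · simp only [uPart_tLetter, apply_ite (monoidElt (CycleRel n)), monoidElt_nil, prod_map_ite,
        count_arc_cycle]
    · simp only [uPart_uLetter, prod_map_monoidElt, List.flatMap_singleton', monoidElt_arc_cycle]
    · simp [uPart, Gen.t, Gen.u]

theorem tProj_monoidElt (U : List (Gen m n)) :
    tProj m n (monoidElt _ U) = monoidElt _ (U.flatMap tPart) := by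
  rw [tProj, lift_monoidElt, prod_map_monoidElt]

theorem uProj_monoidElt (U : List (Gen m n)) :
    uProj m n (monoidElt _ U) = monoidElt _ (U.flatMap uPart) := by
  rw [uProj, lift_monoidElt, prod_map_monoidElt]

theorem tProj_letter (g : Gen m n) : tProj m n (letter g) = monoidElt _ (tPart g) := by
  rw [letter, tProj_monoidElt, List.flatMap_singleton]

theorem uProj_letter (g : Gen m n) : uProj m n (letter g) = monoidElt _ (uPart g) := by
  rw [letter, uProj_monoidElt, List.flatMap_singleton]

/-- Both projections keep exactly the letters s in common; this turns out to be the only constraint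
on their joint image. -/
theorem countHom_tProj (a : GPlus m n) : countHom m (tProj m n a) = countHom n (uProj m n a) := by
  obtain ⟨U, rfl⟩ := monoidElt_surjective _ a
  rw [tProj_monoidElt, uProj_monoidElt, countHom_monoidElt, countHom_monoidElt]
  congr 1
  induction U with
  | nil => rfl
  | cons g U ih =>
    rw [List.flatMap_cons, List.flatMap_cons, List.count_append, List.count_append, ih]
    congr 1
    rcases g with _ | i | j
    · rfl
    · exact List.count_eq_zero.2 (by simpa [tPart] using (succIndex_ne_zero i).symm)
    · exact (List.count_eq_zero.2 (by simpa [uPart] using (succIndex_ne_zero j).symm)).symm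

/-! ### Interleaving a word in `s, t_i` with a word in `s, u_j` -/

/-- The element obtained by interleaving a word in the letters `s, t_1, …, t_m` and a word in the
letters `s, u_1, …, u_n`, with common letters `s`. -/
def interleave : List (ZMod (m + 1)) → List (ZMod (n + 1)) → GPlus m n
  | [], [] => 1
  | [], y :: β => letter (uLetter y) * interleave [] β
  | x :: α, [] => letter (tLetter x) * interleave α []
  | x :: α, y :: β =>
    if x ≠ 0 then letter (tLetter x) * interleave α (y :: β)
    else if y ≠ 0 then letter (uLetter y) * interleave (x :: α) β
    else letter Gen.s * interleave α β
termination_by α β => α.length + β.length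

theorem interleave_nil : (interleave [] [] : GPlus m n) = 1 := by
  rw [interleave]

theorem interleave_left {x : ZMod (m + 1)} (hx : x ≠ 0) (α : List (ZMod (m + 1)))
    (β : List (ZMod (n + 1))) :
    interleave (x :: α) β = letter (tLetter x) * interleave α β := by
  cases β with
  | nil => rw [interleave]
  | cons y β => rw [interleave, if_pos hx]

/-- The definition emits the t_i before the u_j; commutation makes this choice immaterial. -/
theorem interleave_right {y : ZMod (n + 1)} (hy : y ≠ 0) (α : List (ZMod (m + 1)))
    (β : List (ZMod (n + 1))) :
    interleave α (y :: β) = letter (uLetter y) * interleave α β := by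
  induction α with
  | nil => rw [interleave]
  | cons x α ih =>
    by_cases hx : x = 0
    · rw [interleave, if_neg (not_not.2 hx), if_pos hy]
    · rw [interleave_left hx, interleave_left hx, ih, ← mul_assoc, (letter_commute hx hy).eq,
        mul_assoc]

theorem interleave_both (α : List (ZMod (m + 1))) (β : List (ZMod (n + 1))) :
    interleave (0 :: α) (0 :: β) = letter Gen.s * interleave α β := by
  rw [interleave, if_neg (not_not.2 rfl), if_neg (not_not.2 rfl)]

/-- An induction principle for pairs of words with the same number of letters `s`. -/
theorem count_zero_induction {P : List (ZMod (m + 1)) → List (ZMod (n + 1)) → Prop}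
    (nil : P [] []) (left : ∀ x α β, x ≠ 0 → P α β → P (x :: α) β)
    (right : ∀ y α β, y ≠ 0 → P α β → P α (y :: β)) (both : ∀ α β, P α β → P (0 :: α) (0 :: β))
    (α : List (ZMod (m + 1))) (β : List (ZMod (n + 1))) (h : α.count 0 = β.count 0) : P α β := by
  induction α generalizing β with
  | nil =>
    induction β with
    | nil => exact nil
    | cons y β ih =>
      by_cases hy : y = 0
      · subst hy
        simp at h
      · rw [List.count_cons_of_ne hy] at h
        exact right _ _ _ hy (ih h)
  | cons x α ihα =>
    by_cases hx : x = 0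
    · subst hx
      induction β with
      | nil => simp at h
      | cons y β ih =>
        by_cases hy : y = 0
        · subst hy
          rw [List.count_cons_self, List.count_cons_self] at h
          exact both _ _ (ihα _ (Nat.succ.inj h))
        · rw [List.count_cons_of_ne hy] at h
          exact right _ _ _ hy (ih h)
    · rw [List.count_cons_of_ne hx] at h
      exact left _ _ _ hx (ihα _ h)

/-- Equal numbers of s in `α` and `β` ensure that no s is matched across the cut. -/
theorem interleave_append (α : List (ZMod (m + 1))) (β : List (ZMod (n + 1)))
    (h : α.count 0 = β.count 0) (α' : List (ZMod (m + 1))) (β' : List (ZMod (n + 1))) :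
    interleave (α ++ α') (β ++ β') = interleave α β * interleave α' β' := by
  refine count_zero_induction (P := fun α β => interleave (α ++ α') (β ++ β') =
    interleave α β * interleave α' β') ?_ ?_ ?_ ?_ α β h
  · rw [interleave_nil, one_mul, List.nil_append, List.nil_append]
  · intro x α β hx ih
    rw [List.cons_append, interleave_left hx, interleave_left hx, ih, mul_assoc]
  · intro x α β hx ih
    rw [List.cons_append, interleave_right hx, interleave_right hx, ih, mul_assoc]
  · intro α β ih
    rw [List.cons_append, List.cons_append, interleave_both, interleave_both, ih, mul_assoc]

theorem tProj_interleave (α : List (ZMod (m + 1))) (β : List (ZMod (n + 1)))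
    (h : α.count 0 = β.count 0) : tProj m n (interleave α β) = monoidElt _ α := by
  refine count_zero_induction (P := fun α β => tProj m n (interleave α β) = monoidElt _ α)
    ?_ ?_ ?_ ?_ α β h
  · rw [interleave_nil, map_one, monoidElt_nil]
  · intro x α β hx ih
    rw [interleave_left hx, map_mul, ih, tProj_letter, tPart_tLetter, ← monoidElt_cons]
  · intro y α β hy ih
    rw [interleave_right hy, map_mul, ih, tProj_letter, tPart_uLetter, if_neg hy, monoidElt_nil,
      one_mul]
  · intro α β ih
    rw [interleave_both, map_mul, ih, tProj_letter, ← tLetter_zero, tPart_tLetter,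
      ← monoidElt_cons]

theorem uProj_interleave (α : List (ZMod (m + 1))) (β : List (ZMod (n + 1)))
    (h : α.count 0 = β.count 0) : uProj m n (interleave α β) = monoidElt _ β := by
  refine count_zero_induction (P := fun α β => uProj m n (interleave α β) = monoidElt _ β)
    ?_ ?_ ?_ ?_ α β h
  · rw [interleave_nil, map_one, monoidElt_nil]
  · intro x α β hx ih
    rw [interleave_left hx, map_mul, ih, uProj_letter, uPart_tLetter, if_neg hx, monoidElt_nil,
      one_mul]
  · intro y α β hy ih
    rw [interleave_right hy, map_mul, ih, uProj_letter, uPart_uLetter, ← monoidElt_cons]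
  · intro α β ih
    rw [interleave_both, map_mul, ih, uProj_letter, ← uLetter_zero, uPart_uLetter,
      ← monoidElt_cons]

theorem monoidElt_eq_interleave (U : List (Gen m n)) :
    monoidElt (GRel m n) U = interleave (U.flatMap tPart) (U.flatMap uPart) := by
  induction U with
  | nil => rw [List.flatMap_nil, List.flatMap_nil, interleave_nil, monoidElt_nil]
  | cons g U ih =>
    rw [monoidElt_cons, ih, List.flatMap_cons, List.flatMap_cons]
    rcases g with _ | i | j
    · exact (interleave_both _ _).symm
    · exact (interleave_left (succIndex_ne_zero i) _ _).symm
    · exact (interleave_right (succIndex_ne_zero j) _ _).symm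

theorem interleave_replicate_right (α : List (ZMod (m + 1))) :
    interleave α (List.replicate (α.count 0) 0) = monoidElt (GRel m n) (α.map tLetter) := by
  induction α with
  | nil => exact interleave_nil
  | cons x α ih =>
    by_cases hx : x = 0
    · subst hx
      rw [List.count_cons_self, List.replicate_succ, interleave_both, ih]
      rfl
    · rw [List.count_cons_of_ne hx, interleave_left hx, ih]
      rfl

theorem interleave_replicate_left (β : List (ZMod (n + 1))) :
    interleave (List.replicate (β.count 0) 0) β = monoidElt (GRel m n) (β.map uLetter) := by
  induction β with
  | nil => exact interleave_nil
  | cons y β ih =>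
    by_cases hy : y = 0
    · subst hy
      rw [List.count_cons_self, List.replicate_succ, interleave_both, ih]
      rfl
    · rw [List.count_cons_of_ne hy, interleave_right hy, ih]
      rfl

theorem exists_split_of_lt_count {β : List (ZMod (n + 1))} {k : ℕ} (h : k < β.count 0) :
    ∃ β₁ β₂, β = β₁ ++ ([0] ++ β₂) ∧ β₁.count 0 = k := by
  induction β generalizing k with
  | nil => simp at h
  | cons y β ih =>
    by_cases hy : y = 0
    · subst hy
      rcases k with - | k
      · exact ⟨[], β, rfl, rfl⟩
      · rw [List.count_cons_self] at h
        obtain ⟨β₁, β₂, rfl, hk⟩ := ih (Nat.lt_of_succ_lt_succ h)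
        exact ⟨0 :: β₁, β₂, rfl, by rw [List.count_cons_self, hk]⟩
    · rw [List.count_cons_of_ne hy] at h
      obtain ⟨β₁, β₂, rfl, hk⟩ := ih h
      exact ⟨y :: β₁, β₂, rfl, by rw [List.count_cons_of_ne hy, hk]⟩

/-- Induction on the derivation of an equality of words in a presented monoid, in terms of
elementary transformations. -/
theorem eq_of_monoidElt_eq {L X : Type*} {R : FreeMonoid L → FreeMonoid L → Prop}
    (f : List L → X) (hf : ∀ a b, R a b → ∀ p q : List L,
      f (p ++ (a.toList ++ q)) = f (p ++ (b.toList ++ q))) {U V : List L}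
    (h : monoidElt R U = monoidElt R V) : f U = f V := by
  suffices H : ∀ a b : FreeMonoid L, ConGen.Rel R a b → ∀ p q : List L,
      f (p ++ (a.toList ++ q)) = f (p ++ (b.toList ++ q)) by
    simpa using H (FreeMonoid.ofList U) (FreeMonoid.ofList V)
      (PresentedMonoid.mk_eq_mk_iff.1 h) [] []
  intro a b hab
  induction hab with
  | of a b h => exact hf a b h
  | refl a => exact fun _ _ => rfl
  | symm _ ih => exact fun p q => (ih p q).symm
  | trans _ _ ih₁ ih₂ => exact fun p q => (ih₁ p q).trans (ih₂ p q)
  | @mul a b c d _ _ ih₁ ih₂ =>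
    intro p q
    have h₁ := ih₁ p (c.toList ++ q)
    have h₂ := ih₂ (p ++ b.toList) q
    simp only [FreeMonoid.toList_mul, List.append_assoc] at h₁ h₂ ⊢
    exact h₁.trans h₂

/-- It suffices to rotate one full cycle inside `α`. It contains a single s, so cutting `β` around
the matching s isolates a defining relation of G⁺. -/
theorem interleave_congr_left {α α' : List (ZMod (m + 1))} {β : List (ZMod (n + 1))}
    (h : monoidElt (CycleRel m) α = monoidElt _ α') (hc : α.count 0 = β.count 0) :
    interleave α β = interleave α' β := by
  have H := eq_of_monoidElt_eq
    -- The default 1 covers words whose s do not match those of `β`; an elementary transformation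
    -- preserves the number of s, so the two cases never mix.
    (fun α => if α.count 0 = β.count 0 then interleave α β else 1) ?_ h
  · have hc' : α'.count 0 = β.count 0 := by
      have := congrArg (countHom m) h
      rw [countHom_monoidElt, countHom_monoidElt] at this
      rw [← hc, Multiplicative.ofAdd.injective this]
    simpa only [hc, hc', if_true] using H
  rintro a b ⟨i, rfl, rfl⟩ p q
  rw [rotate_arc_cycle]
  simp only [FreeMonoid.toList_ofList, List.count_append, count_arc_cycle]
  split_ifs with h
  · obtain ⟨β₁, β₂, rfl, hk⟩ := exists_split_of_lt_count (β := β) (k := p.count 0) (by omega)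
    have e : ∀ x : ZMod (m + 1), interleave (arc (m + 1) x) [0] =
        monoidElt (GRel m n) ((arc (m + 1) x).map tLetter) := fun x => by
      rw [← interleave_replicate_right, count_arc_cycle]
      rfl
    rw [interleave_append _ _ hk.symm, interleave_append _ _ hk.symm,
      interleave_append (arc _ _) _ (by rw [count_arc_cycle]; rfl),
      interleave_append (arc _ _) _ (by rw [count_arc_cycle]; rfl), e, e,
      monoidElt_map_tLetter (0 + _)]
  · rfl

theorem interleave_congr_right {α : List (ZMod (m + 1))} {β β' : List (ZMod (n + 1))}
    (h : monoidElt (CycleRel n) β = monoidElt _ β') (hc : α.count 0 = β.count 0) :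
    interleave α β = interleave α β' := by
  have H := eq_of_monoidElt_eq
    (fun β => if α.count 0 = β.count 0 then interleave α β else 1) ?_ h
  · have hc' : α.count 0 = β'.count 0 := by
      have := congrArg (countHom n) h
      rw [countHom_monoidElt, countHom_monoidElt] at this
      rw [hc, Multiplicative.ofAdd.injective this]
    simpa only [if_pos hc, if_pos hc'] using H
  rintro a b ⟨i, rfl, rfl⟩ p q
  rw [rotate_arc_cycle]
  simp only [FreeMonoid.toList_ofList, List.count_append, count_arc_cycle]
  split_ifs with h
  · obtain ⟨α₁, α₂, rfl, hk⟩ := exists_split_of_lt_count (β := α) (k := p.count 0) (by omega)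
    have e : ∀ y : ZMod (n + 1), interleave [0] (arc (n + 1) y) =
        monoidElt (GRel m n) ((arc (n + 1) y).map uLetter) := fun y => by
      rw [← interleave_replicate_left, count_arc_cycle]
      rfl
    rw [interleave_append _ _ hk, interleave_append _ _ hk,
      interleave_append _ (arc _ _) (by rw [count_arc_cycle]; rfl),
      interleave_append _ (arc _ _) (by rw [count_arc_cycle]; rfl), e, e,
      monoidElt_map_uLetter (0 + _)]
  · rfl

/-- The two projections are jointly injective. -/
theorem eq_of_proj_eq {a b : GPlus m n} (hT : tProj m n a = tProj m n b)
    (hU : uProj m n a = uProj m n b) : a = b := by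
  have hc := countHom_tProj a
  have hc' := countHom_tProj a
  rw [hT] at hc'
  obtain ⟨U, rfl⟩ := monoidElt_surjective _ a
  obtain ⟨V, rfl⟩ := monoidElt_surjective _ b
  rw [tProj_monoidElt, uProj_monoidElt, countHom_monoidElt, countHom_monoidElt] at hc hc'
  rw [tProj_monoidElt, tProj_monoidElt] at hT
  rw [uProj_monoidElt, uProj_monoidElt] at hU
  -- The arguments are exchanged one at a time; `hc'` says that the intermediate pair still has
  -- matching s.
  rw [monoidElt_eq_interleave, monoidElt_eq_interleave,
    interleave_congr_left hT (Multiplicative.ofAdd.injective hc),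
    interleave_congr_right hU (Multiplicative.ofAdd.injective hc')]

/-- The image of the two projections consists of the pairs with the same exponent of `s`. -/
theorem exists_proj_eq (a : CycleMonoid m) (b : CycleMonoid n) (h : countHom m a = countHom n b) :
    ∃ x, tProj m n x = a ∧ uProj m n x = b := by
  obtain ⟨α, rfl⟩ := monoidElt_surjective _ a
  obtain ⟨β, rfl⟩ := monoidElt_surjective _ b
  rw [countHom_monoidElt, countHom_monoidElt] at h
  have h' := Multiplicative.ofAdd.injective h
  exact ⟨interleave α β, tProj_interleave α β h', uProj_interleave α β h'⟩

end Projections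

end ConjProblem

namespace ConjProblem

/-! ### Cancellation and divisibility in coordinates -/

section Structure

variable {m n : ℕ}

/-- The embedding of the monoid into a group of permutations. -/
def permHom (m n : ℕ) : GPlus m n →* Equiv.Perm (NormalForm m) × Equiv.Perm (NormalForm n) :=
  ((actHom m).comp (tProj m n)).prod ((actHom n).comp (uProj m n))

theorem permHom_injective : Function.Injective (permHom m n) := fun _ _ h =>
  eq_of_proj_eq (actHom_injective (congrArg Prod.fst h)) (actHom_injective (congrArg Prod.snd h))

theorem gPlus_mul_left_cancel {a x y : GPlus m n} (h : a * x = a * y) : x = y := by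
  refine permHom_injective (mul_left_cancel (a := permHom m n a) ?_)
  rw [← map_mul, h, map_mul]

theorem gPlus_mul_right_cancel {b x y : GPlus m n} (h : x * b = y * b) : x = y := by
  refine permHom_injective (mul_right_cancel (b := permHom m n b) ?_)
  rw [← map_mul, h, map_mul]

theorem gPlus_cancellative : Cancellative (GPlus m n) := fun _ _ _ _ h =>
  gPlus_mul_left_cancel (gPlus_mul_right_cancel h)

/-- The coordinate quotients have equal s-exponents, by cancellation in ℕ, and therefore come from
one element. -/
theorem dvd_iff_proj {a b : GPlus m n} :
    a ∣ b ↔ tProj m n a ∣ tProj m n b ∧ uProj m n a ∣ uProj m n b := by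
  constructor
  · rintro ⟨c, rfl⟩
    exact ⟨⟨_, map_mul _ _ _⟩, ⟨_, map_mul _ _ _⟩⟩
  · rintro ⟨⟨p, hp⟩, ⟨q, hq⟩⟩
    have hb := countHom_tProj b
    rw [hp, hq, map_mul, map_mul, countHom_tProj a] at hb
    obtain ⟨c, rfl, rfl⟩ := exists_proj_eq p q (mul_left_cancel hb)
    exact ⟨c, eq_of_proj_eq (by rw [hp, map_mul]) (by rw [hq, map_mul])⟩

theorem rightDvd_iff_proj {a b : GPlus m n} :
    RightDvd a b ↔ RightDvd (tProj m n a) (tProj m n b) ∧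
      RightDvd (uProj m n a) (uProj m n b) := by
  constructor
  · rintro ⟨c, rfl⟩
    exact ⟨⟨_, map_mul _ _ _⟩, ⟨_, map_mul _ _ _⟩⟩
  · rintro ⟨⟨p, hp⟩, ⟨q, hq⟩⟩
    have hb := countHom_tProj b
    rw [hp, hq, map_mul, map_mul, countHom_tProj a] at hb
    obtain ⟨c, rfl, rfl⟩ := exists_proj_eq p q (mul_right_cancel hb)
    exact ⟨c, eq_of_proj_eq (by rw [hp, map_mul]) (by rw [hq, map_mul])⟩

/-! ### The fundamental element -/

theorem flatMap_uPart_tWord : (tWord m n).flatMap uPart = [] := by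
  simp [tWord, List.flatMap_eq_nil_iff, List.mem_ofFn, uPart, Gen.t]

theorem flatMap_tPart_uWord : (uWord m n).flatMap tPart = [] := by
  simp [uWord, List.flatMap_eq_nil_iff, List.mem_ofFn, tPart, Gen.u]

theorem flatMap_tPart_map_tLetter (α : List (ZMod (m + 1))) :
    (α.map (tLetter : _ → Gen m n)).flatMap tPart = α := by
  rw [List.flatMap_map]
  simp [tPart_tLetter]

theorem flatMap_uPart_map_uLetter (β : List (ZMod (n + 1))) :
    (β.map (uLetter : _ → Gen m n)).flatMap uPart = β := by
  rw [List.flatMap_map]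
  simp [uPart_uLetter]

theorem tProj_delta : tProj m n (Delta m n) = cycleElt m := by
  rw [Delta, tProj_monoidElt, ← List.cons_append, List.flatMap_append, flatMap_tPart_uWord,
    ← map_tLetter_arc, flatMap_tPart_map_tLetter, List.append_nil, cycleElt]

theorem uProj_delta : uProj m n (Delta m n) = cycleElt n := by
  rw [Delta, uProj_monoidElt, List.flatMap_cons, List.flatMap_append, flatMap_uPart_tWord,
    List.nil_append, ← List.flatMap_cons, ← map_uLetter_arc, flatMap_uPart_map_uLetter, cycleElt]

theorem delta_commute (a : GPlus m n) : Commute (Delta m n) a := by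
  refine eq_of_proj_eq ?_ ?_
  · rw [map_mul, map_mul, tProj_delta, (cycleElt_commute _).eq]
  · rw [map_mul, map_mul, uProj_delta, (cycleElt_commute _).eq]

theorem monoidElt_singleton_dvd_cycleElt (x : ZMod (m + 1)) :
    monoidElt (CycleRel m) [x] ∣ cycleElt m :=
  ⟨monoidElt _ (arc m (x + 1)), by rw [← monoidElt_arc_cycle x, arc, monoidElt_cons]⟩

theorem letter_dvd_delta (g : Gen m n) : letter g ∣ Delta m n := by
  rw [dvd_iff_proj, tProj_letter, uProj_letter, tProj_delta, uProj_delta]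
  rcases g with _ | i | j
  · exact ⟨monoidElt_singleton_dvd_cycleElt _, monoidElt_singleton_dvd_cycleElt _⟩
  · exact ⟨monoidElt_singleton_dvd_cycleElt _, one_dvd _⟩
  · exact ⟨one_dvd _, monoidElt_singleton_dvd_cycleElt _⟩

theorem isFundamental_delta : IsFundamental (letter (m := m) (n := n)) (Delta m n) := by
  -- As Δ is central, σ is the identity and the complement works on both sides.
  refine ⟨Equiv.refl _, fun g => ?_⟩
  obtain ⟨D, hD⟩ := letter_dvd_delta g
  refine ⟨D, hD, gPlus_mul_left_cancel (a := letter g) ?_⟩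
  rw [Equiv.refl_apply, ← mul_assoc, ← hD, (delta_commute _).eq]

/-! ### Transit elements -/

theorem countHom_eq_of_dvd_cycleElt {δ : CycleMonoid m} (h : δ ∣ cycleElt m)
    (h1 : countHom m δ ≠ 1) : countHom m δ = Multiplicative.ofAdd 1 := by
  obtain ⟨e, he⟩ := h
  have := congrArg (countHom m) he
  rw [cycleElt, countHom_monoidElt, count_arc_cycle, map_mul] at this
  have h₂ := congrArg Multiplicative.toAdd this
  have h₃ : (countHom m δ).toAdd ≠ 0 := h1
  rw [toAdd_mul, toAdd_ofAdd] at h₂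
  exact Multiplicative.toAdd.injective (show (countHom m δ).toAdd = 1 by omega)

/-- Every transit element of `w` is divisible by a transit element of `w` that divides `Δ`. -/
theorem exists_transit_dvd_delta (w A : GPlus m n) (hA : A ≠ 1) (h : A ∣ w * A) :
    ∃ δ, δ ≠ 1 ∧ δ ∣ A ∧ δ ∣ Delta m n ∧ δ ∣ w * δ := by
  have hT : tProj m n A ≠ 1 → ∃ δ, δ ≠ 1 ∧ δ ∣ tProj m n A ∧ δ ∣ cycleElt m ∧
      δ ∣ tProj m n w * δ := fun h1 =>
    exists_transit_dvd_cycleElt h1 (by rw [← map_mul]; exact (dvd_iff_proj.1 h).1)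
  have hU : uProj m n A ≠ 1 → ∃ δ, δ ≠ 1 ∧ δ ∣ uProj m n A ∧ δ ∣ cycleElt n ∧
      δ ∣ uProj m n w * δ := fun h1 =>
    exists_transit_dvd_cycleElt h1 (by rw [← map_mul]; exact (dvd_iff_proj.1 h).2)
  -- Coordinate solutions glue as soon as their s-exponents agree; one of them may be trivial.
  have key : ∀ p q, countHom m p = countHom n q → (p ≠ 1 ∨ q ≠ 1) → p ∣ tProj m n A →
      q ∣ uProj m n A → p ∣ cycleElt m → q ∣ cycleElt n → p ∣ tProj m n w * p →
      q ∣ uProj m n w * q → ∃ δ, δ ≠ 1 ∧ δ ∣ A ∧ δ ∣ Delta m n ∧ δ ∣ w * δ := by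
    intro p q hpq hne hpA hqA hpc hqc hpw hqw
    obtain ⟨δ, rfl, rfl⟩ := exists_proj_eq p q hpq
    refine ⟨δ, ?_, dvd_iff_proj.2 ⟨hpA, hqA⟩, ?_, ?_⟩
    · rintro rfl
      simp at hne
    · rw [dvd_iff_proj, tProj_delta, uProj_delta]
      exact ⟨hpc, hqc⟩
    · rw [dvd_iff_proj, map_mul, map_mul]
      exact ⟨hpw, hqw⟩
  -- A solution without s is paired with 1. Here `countHom m p = 1` is written multiplicatively and
  -- means exponent 0.
  have hTone : ∀ p, p ≠ 1 → p ∣ tProj m n A → p ∣ cycleElt m → p ∣ tProj m n w * p →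
      countHom m p = 1 → ∃ δ, δ ≠ 1 ∧ δ ∣ A ∧ δ ∣ Delta m n ∧ δ ∣ w * δ :=
    fun p h1 hA hc hw hp => key p 1 (by rw [hp, map_one]) (Or.inl h1) hA (one_dvd _) hc
      (one_dvd _) hw (one_dvd _)
  have hUone : ∀ q, q ≠ 1 → q ∣ uProj m n A → q ∣ cycleElt n → q ∣ uProj m n w * q →
      countHom n q = 1 → ∃ δ, δ ≠ 1 ∧ δ ∣ A ∧ δ ∣ Delta m n ∧ δ ∣ w * δ :=
    fun q h1 hA hc hw hq => key 1 q (by rw [hq, map_one]) (Or.inr h1) (one_dvd _) hA (one_dvd _)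
      hc (one_dvd _) hw
  have hdvd : ∀ {k : ℕ} {p a : CycleMonoid k}, p ∣ a → countHom k a = 1 → countHom k p = 1 := by
    rintro k p a ⟨b, rfl⟩ h
    rw [map_mul] at h
    have h₂ := congrArg Multiplicative.toAdd h
    rw [toAdd_mul, toAdd_one] at h₂
    exact Multiplicative.toAdd.injective (show (countHom k p).toAdd = 0 by omega)
  by_cases hT1 : tProj m n A = 1
  · have hU1 : uProj m n A ≠ 1 := fun hU1 => hA (eq_of_proj_eq (by rw [hT1, map_one])
      (by rw [hU1, map_one]))
    obtain ⟨q, h1, h2, h3, h4⟩ := hU hU1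
    exact hUone q h1 h2 h3 h4 (hdvd h2 (by rw [← countHom_tProj, hT1, map_one]))
  obtain ⟨p, p1, p2, p3, p4⟩ := hT hT1
  by_cases hp : countHom m p = 1
  · exact hTone p p1 p2 p3 p4 hp
  by_cases hU1 : uProj m n A = 1
  · exact (hp (hdvd p2 (by rw [countHom_tProj, hU1, map_one]))).elim
  obtain ⟨q, q1, q2, q3, q4⟩ := hU hU1
  by_cases hq : countHom n q = 1
  · exact hUone q q1 q2 q3 q4 hq
  -- Both solutions divide a full cycle and contain s, hence contain it exactly once.
  exact key p q (by rw [countHom_eq_of_dvd_cycleElt p3 hp, countHom_eq_of_dvd_cycleElt q3 hq])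
    (Or.inl p1) p2 q2 p3 q3 p4 q4

theorem propertyP (w : GPlus m n) : PropertyP w (Delta m n) := by
  rintro A ⟨hA, Q, hQ⟩
  obtain ⟨δ, h1, h2, h3, Q', h4⟩ := exists_transit_dvd_delta w A hA ⟨Q, hQ.symm⟩
  exact ⟨δ, ⟨h1, Q', h4.symm⟩, h2, h3⟩

end Structure

/-! ### The sets `O^(k)` -/

section Iteration

variable {M : Type*} [Monoid M] {w D : M}

theorem oIter_subset_succ (k : ℕ) : OIter w D k ⊆ OIter w D (k + 1) := fun V hV =>
  ⟨V, hV, 1, one_dvd _, by rw [one_mul, mul_one]⟩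

theorem oIter_mono : Monotone (OIter w D) := monotone_nat_of_le_succ oIter_subset_succ

theorem oIter_subset_conjPlus (k : ℕ) : OIter w D k ⊆ ConjPlus w := by
  induction k with
  | zero =>
    rintro V rfl
    exact ⟨1, by rw [one_mul, mul_one]⟩
  | succ k ih =>
    rintro V ⟨U, hU, A, -, hA⟩
    obtain ⟨B, hB⟩ := ih hU
    exact ⟨B * A, by rw [mul_assoc, hA, ← mul_assoc, hB, mul_assoc]⟩

/-- `OIter` appends steps at the end, whereas peeling a conjugator produces them at the front. -/
theorem oIter_succ_of_oIter {U V : M} {k : ℕ} (hU : U ∈ OIter w D 1) (hV : V ∈ OIter U D k) :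
    V ∈ OIter w D (k + 1) := by
  induction k generalizing V with
  | zero =>
    obtain rfl : V = U := hV
    exact hU
  | succ k ih =>
    obtain ⟨V', hV', A, hA, h⟩ := hV
    exact ⟨V', ih hV', A, hA, h⟩

end Iteration

section Conjugates

variable {m n : ℕ}

/-- The length of an element. -/
def length (a : GPlus m n) : ℕ := (lengthHom GRel.length_eq a).toAdd

theorem length_mul (a b : GPlus m n) : length (a * b) = length a + length b := by
  rw [length, map_mul, toAdd_mul]
  rfl

theorem length_monoidElt (U : List (Gen m n)) : length (monoidElt (GRel m n) U) = U.length := by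
  rw [length, lengthHom_monoidElt, toAdd_ofAdd]

theorem eq_one_of_length_eq_zero {a : GPlus m n} (h : length a = 0) : a = 1 := by
  obtain ⟨U, rfl⟩ := monoidElt_surjective _ a
  rw [length_monoidElt, List.length_eq_zero_iff] at h
  rw [h, monoidElt_nil]

/-- The relations are homogeneous, so conjugates have equal length, and there are finitely many
words of a given length. -/
theorem finite_conjPlus (w : GPlus m n) : (ConjPlus w).Finite := by
  refine ((List.finite_length_eq (Gen m n) (length w)).image (monoidElt (GRel m n))).subset ?_
  rintro V ⟨A, hA⟩
  obtain ⟨U, rfl⟩ := monoidElt_surjective _ V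
  refine ⟨U, ?_, rfl⟩
  have := congrArg length hA
  rw [length_mul, length_mul, length_monoidElt] at this
  exact (by omega : U.length = length w)

/-- Property P splits off a factor δ of the conjugator with δ ∣ Δ and δ Q = w δ; the remaining,
shorter factor conjugates Q to V. -/
theorem conjPlus_subset_oSet (w : GPlus m n) : ConjPlus w ⊆ OSet w (Delta m n) := by
  suffices H : ∀ N, ∀ w A V : GPlus m n, length A = N → A * V = w * A →
      ∃ k, V ∈ OIter w (Delta m n) k by
    rintro V ⟨A, hA⟩
    obtain ⟨k, hk⟩ := H _ w A V rfl hA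
    exact ⟨k + 1, by omega, oIter_subset_succ k hk⟩
  intro N
  induction N using Nat.strong_induction_on with
  | _ N ih =>
    rintro w A V rfl h
    by_cases hA : A = 1
    · subst hA
      rw [one_mul, mul_one] at h
      exact ⟨0, h⟩
    obtain ⟨δ, ⟨hδ, Q, hQ⟩, ⟨A', rfl⟩, hδD⟩ := propertyP w A ⟨hA, V, h⟩
    have hlt : length A' < length (δ * A') := by
      rw [length_mul]
      have : length δ ≠ 0 := fun h => hδ (eq_one_of_length_eq_zero h)
      omega
    have hA' : A' * V = Q * A' := by
      refine gPlus_mul_left_cancel (a := δ) ?_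
      rw [← mul_assoc, h, ← mul_assoc, ← mul_assoc, hQ]
    obtain ⟨k, hk⟩ := ih _ hlt Q A' V rfl hA'
    exact ⟨k + 1, oIter_succ_of_oIter ⟨w, rfl, δ, hδD, hQ⟩ hk⟩

theorem oSet_eq_conjPlus (w : GPlus m n) : OSet w (Delta m n) = ConjPlus w := by
  refine Set.Subset.antisymm ?_ (conjPlus_subset_oSet w)
  rintro V ⟨k, -, hk⟩
  exact oIter_subset_conjPlus k hk

/-- An increasing chain with finite union is eventually constant. -/
theorem exists_oIter_eq_oSet (w : GPlus m n) :
    ∃ k₀, 1 ≤ k₀ ∧ ∀ k, k₀ ≤ k → OIter w (Delta m n) k = OSet w (Delta m n) := by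
  have hfin : (OSet w (Delta m n)).Finite := oSet_eq_conjPlus w ▸ finite_conjPlus w
  choose! f hf1 hf using fun V (hV : V ∈ OSet w (Delta m n)) => hV
  obtain ⟨N, hN⟩ := (hfin.image f).bddAbove
  refine ⟨N + 1, by omega, fun k hk => Set.Subset.antisymm ?_ fun V hV => ?_⟩
  · exact fun V hV => ⟨k, by omega, hV⟩
  · have := hN (Set.mem_image_of_mem f hV)
    exact oIter_mono (by omega) (hf V hV)

end Conjugates

/-! ### Failure of the LCM conditions -/

section LCM

variable {m n : ℕ}

theorem reduced_of_length_le {v : List (ZMod (m + 1))} (h : v.length ≤ m) : Reduced v :=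
  fun x hx => by
    have := hx.length_le
    rw [length_arc] at this
    omega

theorem reduced_of_count_eq_zero {v : List (ZMod (m + 1))} (h : v.count 0 = 0) : Reduced v :=
  fun x hx => by
    have := hx.sublist.count_le 0
    rw [count_arc_cycle] at this
    omega

/-- Words of at most two letters are too short to contain a full cycle, so they have a single
spelling, and the two given ones begin differently. -/
theorem eq_one_of_dvd_dvd (hm : 2 ≤ m) {y : ZMod (m + 1)} (hy : y ≠ 0) {a : CycleMonoid m}
    (h₁ : a ∣ monoidElt _ [0]) (h₂ : a ∣ monoidElt _ [y, 0]) : a = 1 := by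
  obtain ⟨α, rfl⟩ := monoidElt_surjective _ a
  obtain ⟨p, hp⟩ := h₁
  obtain ⟨q, hq⟩ := h₂
  obtain ⟨p, rfl⟩ := monoidElt_surjective _ p
  obtain ⟨q, rfl⟩ := monoidElt_surjective _ q
  have e₁ := (reduced_of_length_le (by simp; omega)).eq_of_monoidElt_eq (u := α ++ p) hp.symm
  have e₂ := (reduced_of_length_le (by simp; omega)).eq_of_monoidElt_eq (u := α ++ q) hq.symm
  rcases α with - | ⟨x, α⟩
  · rfl
  · rw [List.cons_append, List.cons.injEq] at e₁ e₂
    exact absurd (e₂.1.symm.trans e₁.1) hy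

theorem eq_one_of_rightDvd_rightDvd (hm : 2 ≤ m) {y : ZMod (m + 1)} (hy : y ≠ 0)
    {a : CycleMonoid m} (h₁ : RightDvd a (monoidElt _ [0])) (h₂ : RightDvd a (monoidElt _ [0, y])) :
    a = 1 := by
  obtain ⟨α, rfl⟩ := monoidElt_surjective _ a
  obtain ⟨p, hp⟩ := h₁
  obtain ⟨q, hq⟩ := h₂
  obtain ⟨p, rfl⟩ := monoidElt_surjective _ p
  obtain ⟨q, rfl⟩ := monoidElt_surjective _ q
  have e₁ := (reduced_of_length_le (by simp; omega)).eq_of_monoidElt_eq (u := p ++ α) hp.symm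
  have e₂ := (reduced_of_length_le (by simp; omega)).eq_of_monoidElt_eq (u := q ++ α) hq.symm
  rcases List.eq_nil_or_concat' α with rfl | ⟨α, x, rfl⟩
  · rfl
  · have f₁ := congrArg List.getLast? e₁
    have f₂ := congrArg List.getLast? e₂
    rw [← List.append_assoc, List.getLast?_concat] at f₁ f₂
    simp only [List.getLast?_singleton, List.getLast?_cons_cons, Option.some.injEq] at f₁ f₂
    exact absurd (f₂.symm.trans f₁) hy

/-- An element without `x_0` contains no full cycle, so it has a single spelling and a single first
letter. -/
theorem countHom_ne_one_of_dvd {x y : ZMod (m + 1)} (hxy : x ≠ y) {a : CycleMonoid m}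
    (hx : monoidElt _ [x] ∣ a) (hy : monoidElt _ [y] ∣ a) : countHom m a ≠ 1 := by
  intro h
  obtain ⟨α, rfl⟩ := monoidElt_surjective _ a
  obtain ⟨p, hp⟩ := hx
  obtain ⟨q, hq⟩ := hy
  obtain ⟨p, rfl⟩ := monoidElt_surjective _ p
  obtain ⟨q, rfl⟩ := monoidElt_surjective _ q
  rw [countHom_monoidElt] at h
  have hr := reduced_of_count_eq_zero (Multiplicative.ofAdd.injective h)
  have e₁ := hr.eq_of_monoidElt_eq (u := [x] ++ p) hp.symm
  have e₂ := hr.eq_of_monoidElt_eq (u := [y] ++ q) hq.symm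
  exact hxy (List.cons.inj (e₁.trans e₂.symm)).1

theorem countHom_ne_one_of_rightDvd {x y : ZMod (m + 1)} (hxy : x ≠ y) {a : CycleMonoid m}
    (hx : RightDvd (monoidElt _ [x]) a) (hy : RightDvd (monoidElt _ [y]) a) :
    countHom m a ≠ 1 := by
  intro h
  obtain ⟨α, rfl⟩ := monoidElt_surjective _ a
  obtain ⟨p, hp⟩ := hx
  obtain ⟨q, hq⟩ := hy
  obtain ⟨p, rfl⟩ := monoidElt_surjective _ p
  obtain ⟨q, rfl⟩ := monoidElt_surjective _ q
  rw [countHom_monoidElt] at h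
  have hr := reduced_of_count_eq_zero (Multiplicative.ofAdd.injective h)
  have e₁ := hr.eq_of_monoidElt_eq (u := p ++ [x]) hp.symm
  have e₂ := hr.eq_of_monoidElt_eq (u := q ++ [y]) hq.symm
  exact hxy (by simpa using (List.append_inj_right' (e₁.trans e₂.symm) rfl))

theorem monoidElt_singleton_rightDvd_cycleElt (x : ZMod (m + 1)) :
    RightDvd (monoidElt (CycleRel m) [x]) (cycleElt m) := by
  refine ⟨monoidElt _ (arc m (x + 1)), ?_⟩
  have := arc_cycle_append x
  rw [arc, List.cons_append, List.cons.injEq] at this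
  rw [← monoidElt_append, this.2, monoidElt_arc_cycle]

/-- Two letters t have common multiples with coordinates (c, s) and (c, u_1 s). A least one would
have a u-coordinate dividing both s and u_1 s, hence trivial, and so no s; but then its t-coordinate
cannot begin with both letters. -/
theorem not_rightLCMCondition (hm : 2 ≤ m) (hn : 2 ≤ n) : ¬ RightLCMCondition (GPlus m n) := by
  intro H
  have hij : succIndex (⟨0, by omega⟩ : Fin m) ≠ succIndex ⟨1, by omega⟩ := fun h =>
    absurd (congrArg Fin.val (Fin.succ_injective m h)) zero_ne_one
  generalize (⟨0, by omega⟩ : Fin m) = i at hij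
  generalize (⟨1, by omega⟩ : Fin m) = i' at hij
  set y : ZMod (n + 1) := succIndex ⟨0, by omega⟩
  have hy : y ≠ 0 := succIndex_ne_zero _
  have hcount : countHom m (cycleElt m) = Multiplicative.ofAdd 1 := by
    rw [cycleElt, countHom_monoidElt, count_arc_cycle]
  obtain ⟨d₁, ht₁, hu₁⟩ := exists_proj_eq (cycleElt m) (monoidElt (CycleRel n) [0])
    (by rw [hcount, countHom_monoidElt]; rfl)
  obtain ⟨d₂, ht₂, hu₂⟩ := exists_proj_eq (cycleElt m) (monoidElt (CycleRel n) [y, 0])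
    (by rw [hcount, countHom_monoidElt, List.count_cons_of_ne hy]; rfl)
  have hdvd : ∀ (i : Fin m) (d : GPlus m n), tProj m n d = cycleElt m → letter (Gen.t i) ∣ d :=
    fun i d hd => dvd_iff_proj.2 ⟨by rw [hd, tProj_letter]; exact monoidElt_singleton_dvd_cycleElt _,
      by rw [uProj_letter]; exact one_dvd _⟩
  obtain ⟨c, h₁, h₂, hc⟩ := H (letter (Gen.t i)) (letter (Gen.t i'))
  have c₁ := (dvd_iff_proj.1 (hc d₁ (hdvd i d₁ ht₁) (hdvd i' d₁ ht₁))).2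
  have c₂ := (dvd_iff_proj.1 (hc d₂ (hdvd i d₂ ht₂) (hdvd i' d₂ ht₂))).2
  rw [hu₁] at c₁
  rw [hu₂] at c₂
  have h1 := eq_one_of_dvd_dvd hn hy c₁ c₂
  have g₁ := (dvd_iff_proj.1 h₁).1
  have g₂ := (dvd_iff_proj.1 h₂).1
  rw [tProj_letter] at g₁ g₂
  exact countHom_ne_one_of_dvd hij g₁ g₂ (by rw [countHom_tProj, h1, map_one])

theorem not_leftLCMCondition (hm : 2 ≤ m) (hn : 2 ≤ n) : ¬ LeftLCMCondition (GPlus m n) := by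
  intro H
  have hij : succIndex (⟨0, by omega⟩ : Fin m) ≠ succIndex ⟨1, by omega⟩ := fun h =>
    absurd (congrArg Fin.val (Fin.succ_injective m h)) zero_ne_one
  generalize (⟨0, by omega⟩ : Fin m) = i at hij
  generalize (⟨1, by omega⟩ : Fin m) = i' at hij
  set y : ZMod (n + 1) := succIndex ⟨0, by omega⟩
  have hy : y ≠ 0 := succIndex_ne_zero _
  have hcount : countHom m (cycleElt m) = Multiplicative.ofAdd 1 := by
    rw [cycleElt, countHom_monoidElt, count_arc_cycle]
  obtain ⟨d₁, ht₁, hu₁⟩ := exists_proj_eq (cycleElt m) (monoidElt (CycleRel n) [0])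
    (by rw [hcount, countHom_monoidElt]; rfl)
  obtain ⟨d₂, ht₂, hu₂⟩ := exists_proj_eq (cycleElt m) (monoidElt (CycleRel n) [0, y])
    (by rw [hcount, countHom_monoidElt, List.count_cons_self, List.count_cons_of_ne hy]; rfl)
  have hdvd : ∀ (i : Fin m) (d : GPlus m n), tProj m n d = cycleElt m →
      RightDvd (letter (Gen.t i)) d := fun i d hd => rightDvd_iff_proj.2
    ⟨by rw [hd, tProj_letter]; exact monoidElt_singleton_rightDvd_cycleElt _,
      by rw [uProj_letter]; exact ⟨_, (mul_one _).symm⟩⟩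
  obtain ⟨c, h₁, h₂, hc⟩ := H (letter (Gen.t i)) (letter (Gen.t i'))
  have c₁ := (rightDvd_iff_proj.1 (hc d₁ (hdvd i d₁ ht₁) (hdvd i' d₁ ht₁))).2
  have c₂ := (rightDvd_iff_proj.1 (hc d₂ (hdvd i d₂ ht₂) (hdvd i' d₂ ht₂))).2
  rw [hu₁] at c₁
  rw [hu₂] at c₂
  have h1 := eq_one_of_rightDvd_rightDvd hn hy c₁ c₂
  have g₁ := (rightDvd_iff_proj.1 h₁).1
  have g₂ := (rightDvd_iff_proj.1 h₂).1
  rw [tProj_letter] at g₁ g₂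
  exact countHom_ne_one_of_rightDvd hij g₁ g₂ (by rw [countHom_tProj, h1, map_one])

end LCM

end ConjProblem

namespace ConjProblem

/-! ### Groups with positive presentations -/

section PosGroup

variable {L : Type*} {R : FreeMonoid L → FreeMonoid L → Prop}

/-- The image of a letter in the group. -/
def groupLetter (R : FreeMonoid L → FreeMonoid L → Prop) (x : L) : PosGroup R :=
  PresentedGroup.of x

theorem groupElt_cons (x : L) (e : Bool) (U : List (L × Bool)) :
    groupElt R ((x, e) :: U) =
      (if e then groupLetter R x else (groupLetter R x)⁻¹) * groupElt R U := by
  cases e <;> rfl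

theorem groupElt_surjective : Function.Surjective (groupElt R) := fun g => by
  obtain ⟨w, rfl⟩ := PresentedGroup.mk_surjective _ g
  obtain ⟨U, rfl⟩ := Quot.exists_rep w
  exact ⟨U, rfl⟩

theorem lift_of_freeMonoid {H : Type*} [Group H] (f : L → H) (a : FreeMonoid L) :
    FreeGroup.lift f (FreeMonoid.lift FreeGroup.of a) = FreeMonoid.lift f a := by
  induction a using FreeMonoid.inductionOn' with
  | one => simp
  | of_mul x a ih => simp [ih]

/-- The homomorphism from the group that is given by images of the letters that satisfy the
positive relations. -/
def groupLift {H : Type*} [Group H] (f : L → H)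
    (h : ∀ a b : FreeMonoid L, R a b → FreeMonoid.lift f a = FreeMonoid.lift f b) :
    PosGroup R →* H :=
  PresentedGroup.toGroup (f := f) <| by
    rintro r ⟨a, b, hab, rfl⟩
    rw [map_mul, map_inv, lift_of_freeMonoid, lift_of_freeMonoid, h a b hab, mul_inv_cancel]

theorem groupLift_groupLetter {H : Type*} [Group H] (f : L → H)
    (h : ∀ a b : FreeMonoid L, R a b → FreeMonoid.lift f a = FreeMonoid.lift f b) (x : L) :
    groupLift f h (groupLetter R x) = f x := PresentedGroup.toGroup.of _

theorem lift_groupLetter (a : FreeMonoid L) :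
    FreeMonoid.lift (groupLetter R) a =
      PresentedGroup.mk _ (FreeMonoid.lift FreeGroup.of a) := by
  induction a using FreeMonoid.inductionOn' with
  | one => simp
  | of_mul x a ih => simp [ih, groupLetter, PresentedGroup.of]

/-- The canonical homomorphism from the monoid to the group. -/
def toGroup (R : FreeMonoid L → FreeMonoid L → Prop) : PresentedMonoid R →* PosGroup R :=
  PresentedMonoid.lift (groupLetter R) fun a b h => by
    rw [lift_groupLetter, lift_groupLetter]
    exact PresentedGroup.mk_eq_mk_of_mul_inv_mem ⟨a, b, h, rfl⟩

theorem toGroup_monoidElt (U : List L) :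
    toGroup R (monoidElt R U) = groupElt R (U.map fun x => (x, true)) := by
  rw [toGroup, lift_monoidElt]
  induction U with
  | nil => rfl
  | cons x U ih =>
    rw [List.map_cons, List.prod_cons, ih, List.map_cons, groupElt_cons, if_pos rfl]

theorem groupHom_ext {H : Type*} [Group H] {φ ψ : PosGroup R →* H}
    (h : ∀ x, φ (groupLetter R x) = ψ (groupLetter R x)) : φ = ψ :=
  PresentedGroup.ext h

/-- Every homomorphism from the monoid to a group factors through `toGroup`, so one injective such
map is enough. -/
theorem toGroup_injective {H : Type*} [Group H] {φ : PresentedMonoid R →* H}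
    (hφ : Function.Injective φ) : Function.Injective (toGroup R) := by
  have hR : ∀ a b : FreeMonoid L, R a b → FreeMonoid.lift (fun x => φ (monoidElt R [x])) a =
      FreeMonoid.lift (fun x => φ (monoidElt R [x])) b := fun a b h => by
    have e : FreeMonoid.lift (fun x => φ (monoidElt R [x])) = φ.comp (PresentedMonoid.mk R) :=
      FreeMonoid.hom_eq fun x => rfl
    rw [e, MonoidHom.comp_apply, MonoidHom.comp_apply, PresentedMonoid.mk_eq_mk_of_rel h]
  have hcomp : (groupLift _ hR).comp (toGroup R) = φ := PresentedMonoid.ext R fun x =>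
    groupLift_groupLetter _ hR x
  intro a b h
  refine hφ ?_
  rw [← hcomp, MonoidHom.comp_apply, MonoidHom.comp_apply, h]

/-- The word in a free group that is the image of a word in the group. -/
theorem map_groupElt_eq_mk {α : Type*} [DecidableEq α] (φ : PosGroup R →* FreeGroup α)
    (U : List (L × Bool)) :
    φ (groupElt R U) = FreeGroup.mk (U.flatMap fun p => (if p.2 then φ (groupLetter R p.1)
      else (φ (groupLetter R p.1))⁻¹).toWord) := by
  induction U with
  | nil => exact map_one φ
  | cons p U ih =>
    obtain ⟨x, e⟩ := p
    rw [groupElt_cons, map_mul, ih, List.flatMap_cons, FreeGroup.mk_append, FreeGroup.mk_toWord,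
      apply_ite φ, map_inv]

/-- With finitely many letters, their images form a finite table, so substituting them is primitive
recursive. -/
theorem primrecPred_isConj_map [Primcodable L] [Finite L] {α : Type*} [Primcodable α]
    [DecidableEq α] (φ : PosGroup R →* FreeGroup α) :
    PrimrecPred fun p : List (L × Bool) × List (L × Bool) =>
      IsConj (φ (groupElt R p.1)) (φ (groupElt R p.2)) := by
  have h : Primrec fun U : List (L × Bool) => U.flatMap fun p =>
      (if p.2 then φ (groupLetter R p.1) else (φ (groupLetter R p.1))⁻¹).toWord :=
    Primrec.list_flatMap Primrec.id ((Primrec.dom_finite fun p : L × Bool =>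
      (if p.2 then φ (groupLetter R p.1) else (φ (groupLetter R p.1))⁻¹).toWord).comp
        Primrec.snd).to₂
  refine (FreeGroup.primrecPred_isConj.comp
    ((h.comp Primrec.fst).pair (h.comp Primrec.snd))).of_eq fun p => ?_
  rw [map_groupElt_eq_mk, map_groupElt_eq_mk]

end PosGroup

/-! ### Commuting images of free groups -/

section FreeGroupLift

theorem commute_freeGroup_lift {α G : Type*} [Group G] {g : G} {f : α → G}
    (h : ∀ i, Commute g (f i)) (x : FreeGroup α) : Commute g (FreeGroup.lift f x) := by
  induction x using FreeGroup.induction_on with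
  | C1 => simp
  | of i => simpa using h i
  | inv_of i hi =>
    rw [map_inv]
    exact hi.inv_right
  | mul x y hx hy =>
    rw [map_mul]
    exact hx.mul_right hy

theorem freeGroup_lift_commute {α β G : Type*} [Group G] {f : α → G} {f' : β → G}
    (h : ∀ i j, Commute (f i) (f' j)) (x : FreeGroup α) (y : FreeGroup β) :
    Commute (FreeGroup.lift f x) (FreeGroup.lift f' y) :=
  (commute_freeGroup_lift (fun i => (commute_freeGroup_lift (h i) y).symm) x).symm

end FreeGroupLift

/-! ### The group as a product of free groups, and the conjugacy problems -/

section Decomposition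

variable {m n : ℕ}

/-- The map of the letters of the cycle `s, t_1, …, t_m` to the free group on `t_1, …, t_m` with
`s ↦ (t_1 ⋯ t_m)⁻¹`. -/
def cycleLetter (x : ZMod (m + 1)) : FreeGroup (Fin m) :=
  Fin.cases (motive := fun _ => FreeGroup (Fin m)) (List.ofFn FreeGroup.of).prod⁻¹ FreeGroup.of
    (x : Fin (m + 1))

theorem prod_cycleLetter (x : ZMod (m + 1)) :
    ((arc (m + 1) x).map cycleLetter).prod = 1 := by
  have h : ((arc (m + 1) 0).map (cycleLetter (m := m))).prod = 1 := by
    rw [arc, zero_add, arc_eq_ofFn_succIndex, List.map_cons, List.map_ofFn, List.prod_cons]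
    exact inv_mul_cancel _
  have := List.prod_rotate_eq_one_of_prod_eq_one h x.val
  rwa [← List.map_rotate, rotate_arc_cycle, zero_add, ZMod.natCast_zmod_val] at this

/-- The projection of the group to the free group on `t_1, …, t_m`. -/
def tFree (m n : ℕ) : PosGroup (GRel m n) →* FreeGroup (Fin m) :=
  groupLift (fun g => ((tPart g).map cycleLetter).prod) <| by
    refine lift_eq_of_gRel _ (fun x => ?_) (fun y => ?_) fun i j => ?_
    · simp only [tPart_tLetter, List.map_singleton, List.prod_singleton, prod_cycleLetter]
    · simp only [tPart_uLetter, apply_ite (List.map cycleLetter), apply_ite List.prod,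
        List.map_nil, List.prod_nil, prod_map_ite, count_arc_cycle]
    · simp [tPart, Gen.t, Gen.u]

/-- The projection of the group to the free group on `u_1, …, u_n`. -/
def uFree (m n : ℕ) : PosGroup (GRel m n) →* FreeGroup (Fin n) :=
  groupLift (fun g => ((uPart g).map cycleLetter).prod) <| by
    refine lift_eq_of_gRel _ (fun x => ?_) (fun y => ?_) fun i j => ?_
    · simp only [uPart_tLetter, apply_ite (List.map cycleLetter), apply_ite List.prod,
        List.map_nil, List.prod_nil, prod_map_ite, count_arc_cycle]
    · simp only [uPart_uLetter, List.map_singleton, List.prod_singleton, prod_cycleLetter]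
    · simp [uPart, Gen.t, Gen.u]

/-- The projection of the group to the infinite cyclic group with `s ↦ 1`, `t_i, u_j ↦ 0`. -/
def sFree (m n : ℕ) : PosGroup (GRel m n) →* FreeGroup Unit :=
  groupLift (fun g => ((tPart g).map fun x => if x = 0 then FreeGroup.of () else 1).prod) <| by
    refine lift_eq_of_gRel _ (fun x => ?_) (fun y => ?_) fun i j => ?_
    · simp only [tPart_tLetter, List.map_singleton, List.prod_singleton, prod_map_ite,
        count_arc_cycle]
    · have e : ∀ y, ((tPart (uLetter y : Gen m n)).map fun x =>
          if x = 0 then FreeGroup.of () else 1).prod = if y = 0 then FreeGroup.of () else 1 :=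
        fun y => by
          rw [tPart_uLetter]
          split_ifs <;> simp
      simp only [e]
      rw [prod_map_ite, prod_map_ite, count_arc_cycle, count_arc_cycle]
    · simp [tPart, Gen.t, Gen.u]

theorem commute_toGroup_delta (g : PosGroup (GRel m n)) :
    Commute (toGroup _ (Delta m n)) g := by
  obtain ⟨U, rfl⟩ := groupElt_surjective g
  have h : ∀ x, Commute (toGroup _ (Delta m n)) (groupLetter (GRel m n) x) := fun x =>
    (delta_commute (letter x)).map (toGroup (GRel m n))
  induction U with
  | nil => exact Commute.one_right _
  | cons p U ih =>
    obtain ⟨x, e⟩ := p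
    rw [groupElt_cons]
    cases e
    · exact (h x).inv_right.mul_right ih
    · exact (h x).mul_right ih

/-- Each letter divides Δ, so its inverse is a positive element times Δ⁻¹, and the central powers of
Δ collect in front. -/
theorem exists_delta_pow_mul (g : PosGroup (GRel m n)) :
    ∃ k a, toGroup _ (Delta m n) ^ k * g = toGroup _ a := by
  obtain ⟨U, rfl⟩ := groupElt_surjective g
  induction U with
  | nil => exact ⟨0, 1, by rw [pow_zero, one_mul, map_one]; rfl⟩
  | cons p U ih =>
    obtain ⟨k, a, h⟩ := ih
    obtain ⟨x, e⟩ := p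
    rw [groupElt_cons]
    cases e
    · obtain ⟨D, hD⟩ := letter_dvd_delta x
      refine ⟨k + 1, D * a, ?_⟩
      have hz : toGroup (GRel m n) (Delta m n) = groupLetter _ x * toGroup _ D :=
        (congrArg (toGroup (GRel m n)) hD).trans (map_mul _ _ _)
      have hx : toGroup (GRel m n) (Delta m n) * (groupLetter _ x)⁻¹ = toGroup _ D := by
        rw [(commute_toGroup_delta _).eq, hz, inv_mul_cancel_left]
      rw [if_neg Bool.false_ne_true, map_mul, ← h, pow_succ, mul_assoc, ← mul_assoc _ _⁻¹, hx,
        ← mul_assoc, ((commute_toGroup_delta _).pow_left k).eq, mul_assoc]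
    · refine ⟨k, letter x * a, ?_⟩
      rw [map_mul, ← h, ← mul_assoc, ← mul_assoc]
      congr 1
      exact ((commute_toGroup_delta _).pow_left k).eq

/-- Multiplying a conjugator by a central power of Δ does not change its effect but makes it
positive; the identity then descends to the monoid, which embeds in the group. -/
theorem isConj_toGroup_iff (a b : GPlus m n) :
    IsConj (toGroup (GRel m n) a) (toGroup (GRel m n) b) ↔ ∃ A, A * a = b * A := by
  rw [isConj_iff]
  constructor
  · rintro ⟨c, hc⟩
    obtain ⟨k, A, hA⟩ := exists_delta_pow_mul c
    refine ⟨A, toGroup_injective permHom_injective ?_⟩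
    rw [map_mul, map_mul, ← hA, mul_assoc, ← mul_assoc (toGroup _ b),
      ← ((commute_toGroup_delta (toGroup _ b)).pow_left k).eq, mul_assoc, ← hc]
    group
  · rintro ⟨A, hA⟩
    refine ⟨toGroup _ A, ?_⟩
    rw [← map_mul, hA, map_mul, mul_inv_cancel_right]

/-- The homomorphism from the product of free groups to the group. -/
def ofFree (m n : ℕ) :
    FreeGroup (Fin m) × FreeGroup (Fin n) × FreeGroup Unit →* PosGroup (GRel m n) :=
  (FreeGroup.lift fun i => groupLetter (GRel m n) (Gen.t i)).noncommCoprod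
    ((FreeGroup.lift fun j => groupLetter (GRel m n) (Gen.u j)).noncommCoprod
      (FreeGroup.lift fun _ => toGroup (GRel m n) (Delta m n))
      (freeGroup_lift_commute fun _ _ => (commute_toGroup_delta _).symm))
    fun x y => by
      rw [MonoidHom.noncommCoprod_apply]
      refine Commute.mul_right (freeGroup_lift_commute (fun i j => ?_) _ _)
        (freeGroup_lift_commute (fun _ _ => (commute_toGroup_delta _).symm) _ _)
      exact (letter_commute (succIndex_ne_zero i) (succIndex_ne_zero j)).map (toGroup (GRel m n))

theorem toGroup_delta : toGroup (GRel m n) (Delta m n) = groupLetter _ Gen.s *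
    ((List.ofFn fun i => groupLetter (GRel m n) (Gen.t i)).prod *
      (List.ofFn fun j => groupLetter (GRel m n) (Gen.u j)).prod) := by
  rw [Delta, toGroup, lift_monoidElt, List.map_cons, List.prod_cons, List.map_append,
    List.prod_append, tWord, uWord, List.map_ofFn, List.map_ofFn]
  rfl

/-- Only s needs an argument: with T = t_1 ⋯ t_m and U = u_1 ⋯ u_n commuting and Δ = s T U central,
s = T⁻¹ U⁻¹ Δ. The opposite composition is not needed, since a retraction already transports
conjugacy. -/
theorem ofFree_comp (m n : ℕ) :
    (ofFree m n).comp ((tFree m n).prod ((uFree m n).prod (sFree m n))) = MonoidHom.id _ := by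
  refine groupHom_ext fun x => ?_
  rw [MonoidHom.comp_apply, MonoidHom.prod_apply, MonoidHom.prod_apply, ofFree,
    MonoidHom.noncommCoprod_apply, MonoidHom.noncommCoprod_apply, tFree, uFree, sFree,
    groupLift_groupLetter, groupLift_groupLetter, groupLift_groupLetter, MonoidHom.id_apply]
  rcases x with _ | i | j
  · have hc := commute_toGroup_delta (m := m) (n := n)
    have ht : FreeGroup.lift (fun i => groupLetter (GRel m n) (Gen.t i))
        (List.ofFn FreeGroup.of).prod =
          (List.ofFn fun i => groupLetter (GRel m n) (Gen.t i)).prod := by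
      rw [map_list_prod, List.map_ofFn]
      congr 2
    have hu : FreeGroup.lift (fun i => groupLetter (GRel m n) (Gen.u i))
        (List.ofFn FreeGroup.of).prod =
          (List.ofFn fun i => groupLetter (GRel m n) (Gen.u i)).prod := by
      rw [map_list_prod, List.map_ofFn]
      congr 2
    have htu := freeGroup_lift_commute (f := fun i => groupLetter (GRel m n) (Gen.t i))
      (f' := fun i => groupLetter (GRel m n) (Gen.u i)) (fun i j =>
      (letter_commute (succIndex_ne_zero i) (succIndex_ne_zero j)).map (toGroup (GRel m n)))
      (List.ofFn FreeGroup.of).prod (List.ofFn FreeGroup.of).prod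
    have hΔ := toGroup_delta (m := m) (n := n)
    rw [← ht, ← hu] at hΔ
    simp only [tPart, uPart, List.map_singleton, List.prod_singleton, if_true,
      FreeGroup.lift_apply_of]
    change FreeGroup.lift _ _⁻¹ * (FreeGroup.lift _ _⁻¹ * _) = groupLetter _ Gen.s
    rw [map_inv, map_inv, ← (hc _).eq, ← mul_assoc, ← (hc _).eq, hΔ, htu.eq]
    group
  · simp only [tPart, uPart, List.map_singleton, List.prod_singleton, List.map_nil, List.prod_nil,
      if_neg (succIndex_ne_zero i), map_one, mul_one]
    exact FreeGroup.lift_apply_of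
  · simp only [tPart, uPart, List.map_singleton, List.prod_singleton, List.map_nil, List.prod_nil,
      map_one, mul_one, one_mul]
    exact FreeGroup.lift_apply_of

theorem isConj_iff_isConj_free (g h : PosGroup (GRel m n)) :
    IsConj g h ↔ IsConj (tFree m n g) (tFree m n h) ∧ IsConj (uFree m n g) (uFree m n h) ∧
      IsConj (sFree m n g) (sFree m n h) := by
  constructor
  · exact fun H =>
      ⟨MonoidHom.map_isConj _ H, MonoidHom.map_isConj _ H, MonoidHom.map_isConj _ H⟩
  · rintro ⟨h₁, h₂, h₃⟩
    obtain ⟨a, ha⟩ := isConj_iff.1 h₁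
    obtain ⟨b, hb⟩ := isConj_iff.1 h₂
    obtain ⟨c, hc⟩ := isConj_iff.1 h₃
    have e : ∀ g, ofFree m n (tFree m n g, uFree m n g, sFree m n g) = g := fun g =>
      DFunLike.congr_fun (ofFree_comp m n) g
    rw [isConj_iff]
    refine ⟨ofFree m n (a, b, c), ?_⟩
    rw [← e g, ← e h, ← ha, ← hb, ← hc, ← map_inv, ← map_mul, ← map_mul]
    rfl

/-- With the infinite cyclic factor written as `FreeGroup Unit`, all three coordinate conditions are
instances of the free group algorithm. -/
theorem groupConjugacySolvable : GroupConjugacySolvable (GRel m n) :=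
  (((primrecPred_isConj_map (tFree m n)).and ((primrecPred_isConj_map (uFree m n)).and
    (primrecPred_isConj_map (sFree m n)))).of_eq fun _ =>
      (isConj_iff_isConj_free _ _).symm).computablePred

theorem monoidConjugacySolvable : MonoidConjugacySolvable (GRel m n) := by
  have h : Primrec fun U : List (Gen m n) => U.map fun x => (x, true) :=
    Primrec.list_map Primrec.id (Primrec.snd.pair (Primrec.const true)).to₂
  refine ComputablePred.computable_of_manyOneReducible ?_ (groupConjugacySolvable (m := m) (n := n))
  refine ⟨fun p => (p.1.map fun x => (x, true), p.2.map fun x => (x, true)),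
      ((h.comp Primrec.fst).pair (h.comp Primrec.snd)).to_comp, fun p => ?_⟩
  have := isConj_toGroup_iff (monoidElt (GRel m n) p.1) (monoidElt _ p.2)
  rw [toGroup_monoidElt, toGroup_monoidElt] at this
  exact this.symm

end Decomposition

end ConjProblem

theorem mainTheorem1 (m n : ℕ) (hm : 2 ≤ m) (hn : 2 ≤ n) :
    ConjProblem.Cancellative (ConjProblem.GPlus m n) ∧
    ConjProblem.IsFundamental (ConjProblem.letter (m := m) (n := n)) (ConjProblem.Delta m n) ∧
    (∀ w : ConjProblem.GPlus m n, ConjProblem.PropertyP w (ConjProblem.Delta m n)) ∧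
    (∀ w : ConjProblem.GPlus m n,
      (∃ k₀, 1 ≤ k₀ ∧ ∀ k, k₀ ≤ k →
        ConjProblem.OIter w (ConjProblem.Delta m n) k =
          ConjProblem.OSet w (ConjProblem.Delta m n)) ∧
      ConjProblem.OSet w (ConjProblem.Delta m n) = ConjProblem.ConjPlus w) ∧
    ConjProblem.MonoidConjugacySolvable (ConjProblem.GRel m n) ∧
    ConjProblem.GroupConjugacySolvable (ConjProblem.GRel m n) ∧
    ¬ ConjProblem.RightLCMCondition (ConjProblem.GPlus m n) ∧
    ¬ ConjProblem.LeftLCMCondition (ConjProblem.GPlus m n) := by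
  exact ⟨ConjProblem.gPlus_cancellative, ConjProblem.isFundamental_delta, ConjProblem.propertyP,
    fun w => ⟨ConjProblem.exists_oIter_eq_oSet w, ConjProblem.oSet_eq_conjPlus w⟩,
    ConjProblem.monoidConjugacySolvable, ConjProblem.groupConjugacySolvable,
    ConjProblem.not_rightLCMCondition hm hn, ConjProblem.not_leftLCMCondition hm hn⟩
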